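/- Let $n\ge 1$ and let $\mathbb M$ be a smooth manifold of real dimension $2n+1$ with a strictly pseudoconvex (integrable) CR structure and a contact form $\theta$. Let $\mathcal H=\ker\theta$ be the horizontal bundle, $J$ the complex structure of $\mathcal H$, and $T$ the Reeb field ($\theta(T)=1$, $d\theta(T,\cdot)=0$); put $JT=0$. Let $g$ be the Riemannian metric for which $T$ is a unit vector field orthogonal to $\mathcal H$ and $d\theta(X,Y)=g(X,JY)$, where $d\theta(X,Y)=X\theta(Y)-Y\theta(X)-\theta([X,Y])$. With $D$ the Levi-Civita connection of $g$, the Tanaka-Webster connection is \[ \nabla_XY=D_XY+\tfrac12\theta(X)JY-\theta(Y)D_XT+g(D_XT,Y)T ; \] it is the unique linear connection for which $\theta,g,J$ are parallel and whose torsion satisfies $\mathrm{Tor}(X,Y)=d\theta(X,Y)T$ and $\mathrm{Tor}(T,JX)=-J\,\mathrm{Tor}(T,X)$ for horizontal $X,Y$. Let $\mathrm{Ric}(v,w)=\mathrm{tr}\{u\mapsto R(u,v)w\}$ be its Ricci tensor, with $R(X,Y)=[\nabla_X,\nabla_Y]-\nabla_{[X,Y]}$. Assume that $\mathbb M$ is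 Sasakian, i.e. $\mathrm{Tor}(T,X)=0$ for every $X\in\mathcal H$. Let $\nabla_{\mathcal H}f$ be the horizontal part of the $g$-gradient of $f$, let $Lf=\mathrm{div}(\nabla_{\mathcal H}f)$ be the sub-Laplacian (divergence with respect to the Riemannian volume of $g$), and for $f,h\in C^\infty(\mathbb M)$ let \[ \Gamma(f,h)=\tfrac12\{L(fh)-fLh-hLf\},\qquad \Gamma^Z(f,h)=(Tf)(Th), \] \[ \Gamma_2(f,h)=\tfrac12\{L\Gamma(f,h)-\Gamma(f,Lh)-\Gamma(h,Lf)\},\qquad \Gamma_2^Z(f,h)=\tfrac12\{L\Gamma^Z(f,h)-\Gamma^Z(f,Lh)-\Gamma^Z(h,Lf)\}, \] and write $\Gamma(f)=\Gamma(f,f)$, etc. Let $\rho_1\in\mathbb R$ and suppose that, for every $f\in C^\infty(\mathbb M)$, one has on $\mathbb M$ \[ \mathrm{Ric}(\nabla_{\mathcal H}f,\nabla_{\mathcal H}f)\ \ge\ \rho_1\,\|\nabla_{\mathcal H}f\|^2 . \] Then $\mathbb M$ satisfies the generalized curvature-dimension inequality $\mathrm{CD}(\rho_1,\frac n2,1,2n)$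 with respect to $L$ and $\Gamma^Z$: for every $f\in C^\infty(\mathbb M)$ and every $\nu>0$, \[ \Gamma_2(f)+\nu\,\Gamma_2^Z(f)\ \ge\ \frac1{2n}(Lf)^2+\Big(\rho_1-\frac1\nu\Big)\Gamma(f)+\frac n2\,\Gamma^Z(f)\qquad\text{on }\mathbb M . \] -/

import Mathlib

open Bundle Set VectorField FiberBundle
open scoped Manifold ContDiff ENNReal

set_option linter.unusedSectionVars false

noncomputable section

namespace CRGeometry

section LeviCivita

variable {E : Type*} [NormedAddCommGroup E] [NormedSpace ℝ E] [FiniteDimensional ℝ E]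
  [CompleteSpace E] {H : Type*} [TopologicalSpace H] {I : ModelWithCorners ℝ E H}
  {M : Type*} [TopologicalSpace M] [ChartedSpace H M] [IsManifold I ∞ M]
  [RiemannianBundle (fun x : M ↦ TangentSpace I x)]

instance instFiniteDimensionalTangentSpace (x : M) : FiniteDimensional ℝ (TangentSpace I x) :=
  inferInstanceAs (FiniteDimensional ℝ E)

instance instCompleteSpaceTangentSpace (x : M) : CompleteSpace (TangentSpace I x) :=
  FiniteDimensional.complete ℝ (TangentSpace I x)

/-- The right-hand side of the Koszul formula: `g(∇_X Y, Z)` for the Levi-Civita connection. -/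
def koszul (X Y Z : Π x : M, TangentSpace I x) (x : M) : ℝ :=
  (1 / 2 : ℝ) *
    (mvfderiv I (fun y ↦ inner ℝ (Y y) (Z y)) x (X x)
      + mvfderiv I (fun y ↦ inner ℝ (X y) (Z y)) x (Y x)
      - mvfderiv I (fun y ↦ inner ℝ (X y) (Y y)) x (Z x)
      + inner ℝ (mlieBracket I X Y x) (Z x)
      - inner ℝ (mlieBracket I X Z x) (Y x)
      - inner ℝ (mlieBracket I Y Z x) (X x))

variable [IsContMDiffRiemannianBundle I ∞ E (fun x : M ↦ TangentSpace I x)]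

variable {x : M} {X X' Y Y' Z Z' : Π x : M, TangentSpace I x} {f : M → ℝ}

lemma mdiffAt_inner (hX : MDiffAt (T% X) x) (hY : MDiffAt (T% Y) x) :
    MDiffAt (fun y ↦ inner ℝ (X y) (Y y)) x :=
  MDifferentiableAt.inner_bundle (E := fun x : M ↦ TangentSpace I x) (F := E) (b := fun y ↦ y)
    hX hY

lemma mvfderiv_inner_smul_left (hf : MDiffAt f x) (hX : MDiffAt (T% X) x) (hY : MDiffAt (T% Y) x)
    (v : TangentSpace I x) :
    mvfderiv I (fun y ↦ inner ℝ ((f • X) y) (Y y)) x v =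
      mvfderiv I f x v * inner ℝ (X x) (Y x)
        + f x * mvfderiv I (fun y ↦ inner ℝ (X y) (Y y)) x v := by
  simp [inner_smul_left, mvfderiv_fun_mul hf (mdiffAt_inner hX hY)]
  ring

lemma mvfderiv_inner_smul_right (hf : MDiffAt f x) (hX : MDiffAt (T% X) x) (hY : MDiffAt (T% Y) x)
    (v : TangentSpace I x) :
    mvfderiv I (fun y ↦ inner ℝ (X y) ((f • Y) y)) x v =
      mvfderiv I f x v * inner ℝ (X x) (Y x)
        + f x * mvfderiv I (fun y ↦ inner ℝ (X y) (Y y)) x v := by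
  simp [inner_smul_right, mvfderiv_fun_mul hf (mdiffAt_inner hX hY)]
  ring

lemma mvfderiv_inner_add_left (hX : MDiffAt (T% X) x) (hX' : MDiffAt (T% X') x)
    (hY : MDiffAt (T% Y) x) (v : TangentSpace I x) :
    mvfderiv I (fun y ↦ inner ℝ ((X + X') y) (Y y)) x v =
      mvfderiv I (fun y ↦ inner ℝ (X y) (Y y)) x v
        + mvfderiv I (fun y ↦ inner ℝ (X' y) (Y y)) x v := by
  simp [inner_add_left, mvfderiv_fun_add (mdiffAt_inner hX hY) (mdiffAt_inner hX' hY)]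

lemma mvfderiv_inner_add_right (hX : MDiffAt (T% X) x) (hY : MDiffAt (T% Y) x)
    (hY' : MDiffAt (T% Y') x) (v : TangentSpace I x) :
    mvfderiv I (fun y ↦ inner ℝ (X y) ((Y + Y') y)) x v =
      mvfderiv I (fun y ↦ inner ℝ (X y) (Y y)) x v
        + mvfderiv I (fun y ↦ inner ℝ (X y) (Y' y)) x v := by
  simp [inner_add_right, mvfderiv_fun_add (mdiffAt_inner hX hY) (mdiffAt_inner hX hY')]

lemma koszul_smul_left (hf : MDiffAt f x) (hX : MDiffAt (T% X) x) (hY : MDiffAt (T% Y) x)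
    (hZ : MDiffAt (T% Z) x) : koszul (f • X) Y Z x = f x • koszul X Y Z x := by
  rw [koszul, koszul, mvfderiv_inner_smul_left hf hX hZ, mvfderiv_inner_smul_left hf hX hY]
  simp only [mlieBracket_smul_left hf hX, inner_add_left, inner_smul_left, inner_smul_right, Pi.smul_apply',
    map_smul, inner_neg_left, smul_eq_mul, conj_trivial, neg_smul]
  ring

lemma koszul_smul_right (hf : MDiffAt f x) (hX : MDiffAt (T% X) x) (hY : MDiffAt (T% Y) x)
    (hZ : MDiffAt (T% Z) x) : koszul X Y (f • Z) x = f x • koszul X Y Z x := by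
  rw [koszul, koszul, mvfderiv_inner_smul_right hf hX hZ, mvfderiv_inner_smul_right hf hY hZ]
  simp only [mlieBracket_smul_right hf hZ, inner_add_left, inner_smul_left, inner_smul_right,
    Pi.smul_apply', map_smul, smul_eq_mul, conj_trivial]
  rw [real_inner_comm (Y x) (Z x), real_inner_comm (X x) (Z x)]
  ring

lemma koszul_smul_middle (hf : MDiffAt f x) (hX : MDiffAt (T% X) x) (hY : MDiffAt (T% Y) x)
    (hZ : MDiffAt (T% Z) x) : koszul X (f • Y) Z x =
      f x * koszul X Y Z x + mvfderiv I f x (X x) * inner ℝ (Y x) (Z x) := by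
  rw [koszul, koszul, mvfderiv_inner_smul_right hf hX hY, mvfderiv_inner_smul_left hf hY hZ]
  simp only [mlieBracket_smul_left hf hY, mlieBracket_smul_right hf hY, inner_add_left, inner_smul_left,
    inner_smul_right, Pi.smul_apply', map_smul, inner_neg_left, smul_eq_mul, conj_trivial, neg_smul]
  rw [real_inner_comm (X x) (Y x)]
  ring

lemma koszul_add_left (hX : MDiffAt (T% X) x) (hX' : MDiffAt (T% X') x) (hY : MDiffAt (T% Y) x)
    (hZ : MDiffAt (T% Z) x) : koszul (X + X') Y Z x = koszul X Y Z x + koszul X' Y Z x := by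
  rw [koszul, koszul, koszul, mvfderiv_inner_add_left hX hX' hZ, mvfderiv_inner_add_left hX hX' hY]
  simp only [mlieBracket_add_left hX hX', inner_add_left, inner_add_right, Pi.add_apply, map_add]
  ring

lemma koszul_add_right (hX : MDiffAt (T% X) x) (hY : MDiffAt (T% Y) x) (hZ : MDiffAt (T% Z) x)
    (hZ' : MDiffAt (T% Z') x) : koszul X Y (Z + Z') x = koszul X Y Z x + koszul X Y Z' x := by
  rw [koszul, koszul, koszul, mvfderiv_inner_add_right hX hZ hZ', mvfderiv_inner_add_right hY hZ hZ']
  simp only [mlieBracket_add_right hZ hZ', inner_add_left, inner_add_right, Pi.add_apply, map_add]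
  ring

lemma koszul_add_middle (hX : MDiffAt (T% X) x) (hY : MDiffAt (T% Y) x) (hY' : MDiffAt (T% Y') x)
    (hZ : MDiffAt (T% Z) x) : koszul X (Y + Y') Z x = koszul X Y Z x + koszul X Y' Z x := by
  rw [koszul, koszul, koszul, mvfderiv_inner_add_right hX hY hY', mvfderiv_inner_add_left hY hY' hZ]
  simp only [mlieBracket_add_left hY hY', mlieBracket_add_right hY hY', inner_add_left, inner_add_right,
    Pi.add_apply, map_add]
  ring

/-- The Koszul expression as a bilinear form in its first and last arguments, at a point where
the vector field `Y` is differentiable. -/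
def koszulForm (Y : Π x : M, TangentSpace I x) (x : M) (hY : MDiffAt (T% Y) x) :
    TangentSpace I x →L[ℝ] TangentSpace I x →L[ℝ] ℝ :=
  TensorialAt.mkHom₂ (I := I) (F := E) (F' := E) (V := fun y : M ↦ TangentSpace I y)
    (V' := fun y : M ↦ TangentSpace I y) (fun X Z ↦ koszul X Y Z x) x
    (fun _ hZ ↦ ⟨fun hf hX ↦ koszul_smul_left hf hX hY hZ,
      fun hX hX' ↦ koszul_add_left hX hX' hY hZ⟩)
    (fun _ hX ↦ ⟨fun hf hZ ↦ koszul_smul_right hf hX hY hZ,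
      fun hZ hZ' ↦ koszul_add_right hX hY hZ hZ'⟩)

lemma koszulForm_eq (hY : MDiffAt (T% Y) x) (u v : TangentSpace I x) :
    koszulForm Y x hY u v = koszul (extend E u) Y (extend E v) x := by
  simp only [koszulForm, TensorialAt.mkHom₂_apply_eq_extend]

open scoped Classical in
/-- The covariant derivative `v ↦ ∇_v Y` of the Levi-Civita connection, obtained from the
Koszul formula. -/
def leviCivitaFun (Y : Π x : M, TangentSpace I x) (x : M) :
    TangentSpace I x →L[ℝ] TangentSpace I x :=
  if hY : MDiffAt (T% Y) x then
    InnerProductSpace.continuousLinearMapOfBilin (𝕜 := ℝ) (koszulForm Y x hY)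
  else 0

lemma inner_leviCivitaFun (hY : MDiffAt (T% Y) x) (u v : TangentSpace I x) :
    inner ℝ (leviCivitaFun Y x u) v = koszul (extend E u) Y (extend E v) x := by
  rw [leviCivitaFun, dif_pos hY, ← koszulForm_eq hY]
  exact InnerProductSpace.continuousLinearMapOfBilin_apply (𝕜 := ℝ) (koszulForm Y x hY) u v

variable (I M) in
/-- The Levi-Civita connection of a Riemannian manifold. -/
def leviCivita : CovariantDerivative I E (fun x : M ↦ TangentSpace I x) where
  toFun := leviCivitaFun
  isCovariantDerivativeOnUniv :=
    { add := by
        intro Y Y' x hY hY' _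
        ext u
        refine ext_inner_right ℝ fun v ↦ ?_
        rw [inner_leviCivitaFun (mdifferentiableAt_add_section hY hY'),
          koszul_add_middle (mdifferentiableAt_extend ..) hY hY' (mdifferentiableAt_extend ..),
          add_apply, inner_add_left, inner_leviCivitaFun hY,
          inner_leviCivitaFun hY']
      leibniz := by
        intro Y f x hY hf _
        ext u
        refine ext_inner_right ℝ fun v ↦ ?_
        rw [inner_leviCivitaFun (hf.smul_section hY),
          koszul_smul_middle hf (mdifferentiableAt_extend ..) hY (mdifferentiableAt_extend ..)]
        simp [inner_add_left, inner_smul_left, inner_leviCivitaFun hY] }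

end LeviCivita

section Geometry

variable {E : Type*} [NormedAddCommGroup E] [NormedSpace ℝ E] [FiniteDimensional ℝ E]
  [CompleteSpace E] {H : Type*} [TopologicalSpace H] {I : ModelWithCorners ℝ E H}
  {M : Type*} [TopologicalSpace M] [ChartedSpace H M]

/-- The exterior derivative of a one-form, evaluated on vector fields:
`dα(X, Y) = X(α(Y)) - Y(α(X)) - α([X, Y])` (no factor `1/2`). -/
def oneFormDeriv (α : Π x : M, TangentSpace I x →L[ℝ] ℝ) (X Y : Π x : M, TangentSpace I x)
    (x : M) : ℝ :=
  mvfderiv I (fun y ↦ α y (Y y)) x (X x) - mvfderiv I (fun y ↦ α y (X y)) x (Y x)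
    - α x (mlieBracket I X Y x)

variable [IsManifold I ∞ M]

/-- The curvature `R(X, Y)Z = ∇_X ∇_Y Z - ∇_Y ∇_X Z - ∇_[X, Y] Z` of a linear connection.
In Mathlib's argument order, `cov Z x (X x)` is `∇_X Z` at `x`. -/
def curvature (cov : CovariantDerivative I E (fun x : M ↦ TangentSpace I x))
    (X Y Z : Π x : M, TangentSpace I x) (x : M) : TangentSpace I x :=
  cov (fun y ↦ cov Z y (Y y)) x (X x) - cov (fun y ↦ cov Z y (X y)) x (Y x)
    - cov Z x (mlieBracket I X Y x)

variable [RiemannianBundle (fun x : M ↦ TangentSpace I x)]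

/-- The Ricci tensor of a linear connection: `Ric(v, w)` is the trace of `u ↦ R(u, v)w`, computed
in an orthonormal basis of the tangent space. Tangent vectors are extended to vector fields which
are smooth near the base point. -/
def ricci (cov : CovariantDerivative I E (fun x : M ↦ TangentSpace I x)) (x : M)
    (v w : TangentSpace I x) : ℝ :=
  ∑ i, inner ℝ
    (curvature cov (extend E (stdOrthonormalBasis ℝ (TangentSpace I x) i)) (extend E v)
      (extend E w) x)
    (stdOrthonormalBasis ℝ (TangentSpace I x) i)

/-- The Riemannian gradient. -/
def riemannianGradient (f : M → ℝ) (x : M) : TangentSpace I x :=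
  (InnerProductSpace.toDual ℝ (TangentSpace I x)).symm (mvfderiv I f x)

variable [IsContMDiffRiemannianBundle I ∞ E (fun x : M ↦ TangentSpace I x)]

/-- The divergence with respect to the Riemannian volume: the trace of `v ↦ ∇_v X`, for the
Levi-Civita connection. -/
def divergence (X : Π x : M, TangentSpace I x) (x : M) : ℝ :=
  LinearMap.trace ℝ (TangentSpace I x) (leviCivita I M X x : _ →ₗ[ℝ] _)

variable (I M) in
/-- A strictly pseudoconvex CR manifold of hypersurface type with a chosen contact form `θ`. The
horizontal bundle is `ker θ`, and its complex structure `J` is extended to the tangent bundle by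
`J T = 0`, with `T` the Reeb field. The Riemannian metric of `M` is the associated Webster
metric: `T` is a unit vector orthogonal to `ker θ`, and `dθ(X, Y) = g(X, J Y)`, so that on
horizontal vectors `g` is the (positive definite) Levi form `dθ(J X, Y)`. -/
structure PseudohermitianStructure where
  /-- The contact form. -/
  contactForm : Π x : M, TangentSpace I x →L[ℝ] ℝ
  /-- The Reeb vector field. -/
  reeb : Π x : M, TangentSpace I x
  /-- The complex structure of the horizontal bundle, extended by `J T = 0`. -/
  J : Π x : M, TangentSpace I x →L[ℝ] TangentSpace I x
  contMDiff_reeb : ContMDiff I (I.prod 𝓘(ℝ, E)) ∞ (fun x ↦ TotalSpace.mk' E x (reeb x))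
  contMDiff_J : ContMDiff I (I.prod 𝓘(ℝ, E →L[ℝ] E)) ∞
    (fun x ↦ TotalSpace.mk' (E →L[ℝ] E) (E := fun x : M ↦ TangentSpace I x →L[ℝ] TangentSpace I x)
      x (J x))
  contactForm_reeb : ∀ x, contactForm x (reeb x) = 1
  J_reeb : ∀ x, J x (reeb x) = 0
  J_J : ∀ x v, J x (J x v) = -v + contactForm x v • reeb x
  inner_reeb : ∀ x v, inner ℝ (reeb x) v = contactForm x v
  oneFormDeriv_contactForm : ∀ (X Y : Π x : M, TangentSpace I x) (x : M),
    MDiffAt (T% X) x → MDiffAt (T% Y) x →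
      oneFormDeriv contactForm X Y x = inner ℝ (X x) (J x (Y x))
  /-- Integrability of the CR structure: the Nijenhuis tensor of `J` vanishes on horizontal
  vector fields. -/
  integrable : ∀ (X Y : Π x : M, TangentSpace I x) (x : M),
    MDiffAt (T% X) x → MDiffAt (T% Y) x →
    (∀ y, contactForm y (X y) = 0) → (∀ y, contactForm y (Y y) = 0) →
      mlieBracket I (fun y ↦ J y (X y)) (fun y ↦ J y (Y y)) x - mlieBracket I X Y x =
        J x (mlieBracket I (fun y ↦ J y (X y)) Y x + mlieBracket I X (fun y ↦ J y (Y y)) x)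

namespace PseudohermitianStructure

variable (S : PseudohermitianStructure I M)

/-- The difference of the Tanaka-Webster and the Levi-Civita connections:
`A(v, w) = 1/2 θ(v) J w - θ(w) D_v T + g(D_v T, w) T`, with `D` the Levi-Civita connection.
The arguments are in the order `w`, `v`. -/
def tanakaWebsterDifference (x : M) :
    TangentSpace I x →L[ℝ] TangentSpace I x →L[ℝ] TangentSpace I x :=
  LinearMap.toContinuousLinearMap
    { toFun := fun w ↦
        ((1 / 2 : ℝ) • S.contactForm x).smulRight (S.J x w)
          - S.contactForm x w • leviCivita I M S.reeb x
          + ((innerSL ℝ w).comp (leviCivita I M S.reeb x)).smulRight (S.reeb x)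
      map_add' := by
        intro w w'
        ext v
        simp
        module
      map_smul' := by
        intro c w
        ext v
        simp
        module }

/-- The Tanaka-Webster connection
`∇_v W = D_v W + 1/2 θ(v) J W - θ(W) D_v T + g(D_v T, W) T`, with `D` the Levi-Civita connection
of the Webster metric. It is the unique linear connection for which `θ`, `g`, `J` (hence `T` and
the horizontal bundle) are parallel and whose torsion satisfies `Tor(X, Y) = dθ(X, Y) T` and
`Tor(T, J X) = - J Tor(T, X)` for horizontal `X`, `Y`. -/
def tanakaWebster : CovariantDerivative I E (fun x : M ↦ TangentSpace I x) :=
  (leviCivita I M).addOneForm S.tanakaWebsterDifference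

/-- A pseudohermitian manifold is Sasakian if its pseudohermitian torsion `X ↦ Tor(T, X)`
vanishes, where `Tor` is the torsion of the Tanaka-Webster connection. -/
def IsSasakian : Prop :=
  ∀ (x : M) (v : TangentSpace I x), S.contactForm x v = 0 →
    S.tanakaWebster.torsion x (S.reeb x) v = 0

/-- The horizontal gradient: the orthogonal projection of the gradient on `ker θ`. -/
def horizontalGradient (f : M → ℝ) (x : M) : TangentSpace I x :=
  riemannianGradient f x - S.contactForm x (riemannianGradient f x) • S.reeb x

/-- The sub-Laplacian `L f = div (∇_H f)`. -/
def subLaplacian (f : M → ℝ) (x : M) : ℝ := divergence (S.horizontalGradient f) x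

/-- The vertical form `Γ^Z(f, g) = (T f)(T g)`. -/
def verticalForm (f g : M → ℝ) (x : M) : ℝ :=
  mvfderiv I f x (S.reeb x) * mvfderiv I g x (S.reeb x)

end PseudohermitianStructure

end Geometry

section CurvatureDimension

variable {M : Type*}

/-- The carré du champ of an operator `L`. -/
def gammaForm (L : (M → ℝ) → M → ℝ) (f g : M → ℝ) (x : M) : ℝ :=
  (1 / 2 : ℝ) * (L (fun y ↦ f y * g y) x - f x * L g x - g x * L f x)

/-- The iterate of a bilinear form `B` with respect to an operator `L`. It is `Γ₂` if `B = Γ`,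
and `Γ₂^Z` if `B = Γ^Z`. -/
def gammaTwoForm (L : (M → ℝ) → M → ℝ) (B : (M → ℝ) → (M → ℝ) → M → ℝ) (f g : M → ℝ) (x : M) : ℝ :=
  (1 / 2 : ℝ) * (L (B f g) x - B f (L g) x - B g (L f) x)

/-- The generalized curvature-dimension inequality `CD(ρ₁, ρ₂, κ, d)` with respect to `L` and
`Γ^Z`, with `0 < d ≤ ∞`. -/
def CurvatureDimension {E : Type*} [NormedAddCommGroup E] [NormedSpace ℝ E]
    {H : Type*} [TopologicalSpace H] (I : ModelWithCorners ℝ E H)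
    [TopologicalSpace M] [ChartedSpace H M]
    (L : (M → ℝ) → M → ℝ) (ΓZ : (M → ℝ) → (M → ℝ) → M → ℝ) (ρ₁ ρ₂ κ : ℝ) (d : ℝ≥0∞) : Prop :=
  0 < ρ₂ ∧ 0 ≤ κ ∧ 0 < d ∧
    ∀ f : M → ℝ, ContMDiff I 𝓘(ℝ, ℝ) ∞ f → ∀ ν : ℝ, 0 < ν → ∀ x : M,
      gammaTwoForm L (gammaForm L) f f x + ν * gammaTwoForm L ΓZ f f x ≥
        (d⁻¹).toReal * L f x ^ 2 + (ρ₁ - κ / ν) * gammaForm L f f x + ρ₂ * ΓZ f f x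

end CurvatureDimension

end CRGeometry

end

/-! Write Z for the horizontal gradient of f, τ = Tf and N = ∇Z. Vanishing of Tor(T, ·) forces D_v T
= -½ J v. Hence ∇ is metric, its torsion is g(X, JY) T for all fields X, Y, and its trace gives the
Riemannian divergence. The core is the failure of N to be symmetric
(`tanakaWebster_horizontalGradient_sub`): on horizontal vectors its antisymmetric part is -(τ/2)
g(·, J·), and ∇_T Z = ∇_H τ.

Bochner identities. The same asymmetry gives ∇_H |Z|² = 2(∇_Z Z - τ JZ). Take the divergence, using
div(∇_Z Z) = Ric(Z, Z) + Z(Lf) + tr N² - g(∇_H τ, JZ) (`divergence_tanakaWebster`) and div(JZ) =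
tr(JN) = -nτ (`divergence_J`, `trace_J_mul_tanakaWebster`). The result (`gammaTwoForm_gammaForm`) is
Γ₂(f) = Ric(Z, Z) + tr N² - 2 g(∇_H τ, JZ) + n τ². The Reeb field is Killing, so T commutes with L,
and Γ₂^Z(f) = |∇_H τ|² (`gammaTwoForm_verticalForm`).

Conclusion. Young's inequality 2 g(∇_H τ, JZ) ≤ ν |∇_H τ|² + |Z|²/ν costs the term Γ(f)/ν. If S is
the symmetric part of the horizontal block of N, then tr N² = |S|² - (n/2) τ², and Cauchy-Schwarz in
dimension 2n gives |S|² ≥ (Lf)²/(2n), since tr S = Lf (`sq_subLaplacian_le`). What remains of n τ²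
is (n/2) τ². -/

noncomputable section

namespace CRGeometry

/-! ### The Levi-Civita connection is metric and torsion-free -/

section LeviCivitaProperties

variable {E : Type*} [NormedAddCommGroup E] [NormedSpace ℝ E] [FiniteDimensional ℝ E]
  [CompleteSpace E] {H : Type*} [TopologicalSpace H] {I : ModelWithCorners ℝ E H}
  {M : Type*} [TopologicalSpace M] [ChartedSpace H M] [IsManifold I ∞ M]
  [RiemannianBundle (fun x : M ↦ TangentSpace I x)]
  [IsContMDiffRiemannianBundle I ∞ E (fun x : M ↦ TangentSpace I x)]
  {x : M} {X Y Z : Π x : M, TangentSpace I x}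

lemma inner_leviCivita_eq_koszul (hX : MDiffAt (T% X) x) (hY : MDiffAt (T% Y) x)
    (hZ : MDiffAt (T% Z) x) :
    inner ℝ (leviCivita I M Y x (X x)) (Z x) = koszul X Y Z x := by
  have h : inner ℝ (leviCivita I M Y x (X x)) (Z x) = koszulForm Y x hY (X x) (Z x) := by
    change inner ℝ (leviCivitaFun Y x (X x)) (Z x) = _
    rw [inner_leviCivitaFun hY, koszulForm_eq]
  rw [h, koszulForm]
  exact TensorialAt.mkHom₂_apply _ _ hX hZ

lemma inner_leviCivita_add (hX : MDiffAt (T% X) x) (hY : MDiffAt (T% Y) x)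
    (hZ : MDiffAt (T% Z) x) :
    mvfderiv I (fun y ↦ inner ℝ (Y y) (Z y)) x (X x) =
      inner ℝ (leviCivita I M Y x (X x)) (Z x) + inner ℝ (Y x) (leviCivita I M Z x (X x)) := by
  rw [real_inner_comm (leviCivita I M Z x (X x)) (Y x), inner_leviCivita_eq_koszul hX hY hZ,
    inner_leviCivita_eq_koszul hX hZ hY, koszul, koszul, mlieBracket_swap_apply (V := Z) (W := Y)]
  simp only [real_inner_comm, inner_neg_left]
  ring

lemma leviCivita_torsion_free (hX : MDiffAt (T% X) x) (hY : MDiffAt (T% Y) x) :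
    leviCivita I M Y x (X x) - leviCivita I M X x (Y x) = mlieBracket I X Y x := by
  refine ext_inner_right ℝ fun v ↦ ?_
  have hv : MDiffAt (T% (extend E v)) x := mdifferentiableAt_extend ..
  have h1 := inner_leviCivita_eq_koszul hX hY hv
  have h2 := inner_leviCivita_eq_koszul hY hX hv
  rw [extend_apply_self] at h1 h2
  rw [inner_sub_left, h1, h2, koszul, koszul, mlieBracket_swap_apply (V := Y) (W := X)]
  simp only [extend_apply_self, inner_neg_left, real_inner_comm]
  ring

end LeviCivitaProperties

/-! ### The Tanaka-Webster connection in the Sasakian case -/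

namespace PseudohermitianStructure

variable {E : Type*} [NormedAddCommGroup E] [NormedSpace ℝ E] [FiniteDimensional ℝ E]
  [CompleteSpace E] {H : Type*} [TopologicalSpace H] {I : ModelWithCorners ℝ E H}
  {M : Type*} [TopologicalSpace M] [ChartedSpace H M] [IsManifold I ∞ M]
  [RiemannianBundle (fun x : M ↦ TangentSpace I x)]
  [IsContMDiffRiemannianBundle I ∞ E (fun x : M ↦ TangentSpace I x)]
  (S : PseudohermitianStructure I M)
  {x : M} {X Y Z : Π x : M, TangentSpace I x}

/-- The two ways of computing J³v, namely J² applied to Jv and J applied to J²v, differ by θ(Jv) T.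
-/
lemma contactForm_J (x : M) (v : TangentSpace I x) : S.contactForm x (S.J x v) = 0 := by
  have h1 := S.J_J x (S.J x v)
  rw [S.J_J x v] at h1
  have h3 : S.contactForm x (S.J x v) • S.reeb x = 0 := by
    have : S.J x (-v + S.contactForm x v • S.reeb x) = - S.J x v := by simp [S.J_reeb]
    rw [this] at h1
    simpa using h1.symm
  have h4 := congrArg (S.contactForm x) h3
  simpa [S.contactForm_reeb] using h4

lemma inner_reeb_right (x : M) (v : TangentSpace I x) :
    inner ℝ v (S.reeb x) = S.contactForm x v := by
  rw [real_inner_comm, S.inner_reeb]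

/-- By the Webster condition g(v, Jw) is dθ(v, w), which is antisymmetric. -/
lemma inner_J_swap (x : M) (v w : TangentSpace I x) :
    inner ℝ v (S.J x w) = - inner ℝ w (S.J x v) := by
  have hv : MDiffAt (T% (extend E v)) x := mdifferentiableAt_extend ..
  have hw : MDiffAt (T% (extend E w)) x := mdifferentiableAt_extend ..
  have h1 := S.oneFormDeriv_contactForm _ _ x hv hw
  have h2 := S.oneFormDeriv_contactForm _ _ x hw hv
  rw [extend_apply_self, extend_apply_self] at h1 h2
  rw [← h1, ← h2, oneFormDeriv, oneFormDeriv, mlieBracket_swap_apply, map_neg]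
  ring

lemma inner_J_left (x : M) (v w : TangentSpace I x) :
    inner ℝ (S.J x v) w = - inner ℝ v (S.J x w) := by
  rw [real_inner_comm, S.inner_J_swap]

lemma norm_J_sq (x : M) (v : TangentSpace I x) (hv : S.contactForm x v = 0) :
    inner ℝ (S.J x v) (S.J x v) = inner ℝ v v := by
  rw [S.inner_J_left, S.J_J, hv]
  simp

lemma mdiffAt_reeb : MDiffAt (T% S.reeb) x :=
  (S.contMDiff_reeb x).mdifferentiableAt (by simp)

lemma contactForm_leviCivita_reeb (v : TangentSpace I x) :
    S.contactForm x (leviCivita I M S.reeb x v) = 0 := by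
  have h := inner_leviCivita_add (mdifferentiableAt_extend I E v) S.mdiffAt_reeb S.mdiffAt_reeb
  have hc : (fun y ↦ inner ℝ (S.reeb y) (S.reeb y)) = fun _ : M ↦ (1 : ℝ) := by
    ext y; rw [S.inner_reeb, S.contactForm_reeb]
  rw [hc, mvfderiv_const, extend_apply_self, S.inner_reeb, S.inner_reeb_right] at h
  simp only [zero_apply] at h
  linarith

lemma tanakaWebster_apply (Y : Π x : M, TangentSpace I x) (x : M) (v : TangentSpace I x) :
    S.tanakaWebster Y x v = leviCivita I M Y x v
      + (((1 / 2 : ℝ) * S.contactForm x v) • S.J x (Y x)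
        - S.contactForm x (Y x) • leviCivita I M S.reeb x v
        + inner ℝ (Y x) (leviCivita I M S.reeb x v) • S.reeb x) := by
  change leviCivita I M Y x v + S.tanakaWebsterDifference x (Y x) v = _
  simp [tanakaWebsterDifference]

lemma tanakaWebster_reeb (v : TangentSpace I x) : S.tanakaWebster S.reeb x v = 0 := by
  rw [tanakaWebster_apply, S.contactForm_reeb, S.J_reeb, S.inner_reeb,
    S.contactForm_leviCivita_reeb]
  simp

variable {S} in
lemma IsSasakian.leviCivita_reeb (hS : S.IsSasakian) (v : TangentSpace I x) :
    leviCivita I M S.reeb x v = - (1 / 2 : ℝ) • S.J x v := by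
  have key : ∀ w : TangentSpace I x, S.contactForm x w = 0 →
      leviCivita I M S.reeb x w = - (1 / 2 : ℝ) • S.J x w ∧
        inner ℝ w (leviCivita I M S.reeb x (S.reeb x)) = 0 := by
    intro w hw
    have hw' : MDiffAt (T% (extend E w)) x := mdifferentiableAt_extend ..
    have h := hS x w hw
    have h1 := S.tanakaWebster.torsion_apply S.mdiffAt_reeb hw'
    rw [extend_apply_self, h, tanakaWebster_reeb, tanakaWebster_apply,
      ← leviCivita_torsion_free S.mdiffAt_reeb hw', extend_apply_self, S.contactForm_reeb, hw] at h1
    -- This is Tor(T, w) = 0 written out with D. Its component along T says that D_T T is orthogonal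
    -- to w; the rest determines D_w T.
    have h2 : (1 / 2 : ℝ) • S.J x w
        + inner ℝ w (leviCivita I M S.reeb x (S.reeb x)) • S.reeb x
        + leviCivita I M S.reeb x w = 0 := by
      rw [h1]; module
    have h3 : inner ℝ w (leviCivita I M S.reeb x (S.reeb x)) = 0 := by
      have := congrArg (fun u ↦ inner ℝ u (S.reeb x)) h2
      simpa [inner_add_left, inner_smul_left, S.contactForm_leviCivita_reeb, S.inner_reeb_right,
        S.contactForm_J, S.contactForm_reeb] using this
    refine ⟨?_, h3⟩
    rw [h3] at h2
    rw [zero_smul, add_zero] at h2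
    rw [neg_smul]
    exact eq_neg_of_add_eq_zero_right h2
  have hT : leviCivita I M S.reeb x (S.reeb x) = 0 := by
    refine ext_inner_left ℝ fun w ↦ ?_
    have h1 := (key (w - S.contactForm x w • S.reeb x) (by simp [S.contactForm_reeb])).2
    rw [inner_sub_left, inner_smul_left, S.inner_reeb,
      S.contactForm_leviCivita_reeb] at h1
    simpa using h1
  have h1 := (key (v - S.contactForm x v • S.reeb x) (by simp [S.contactForm_reeb])).1
  simpa [hT, S.J_reeb] using h1

variable {S} in
lemma IsSasakian.tanakaWebster_apply (hS : S.IsSasakian) (Y : Π x : M, TangentSpace I x) (x : M)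
    (v : TangentSpace I x) :
    S.tanakaWebster Y x v = leviCivita I M Y x v
      + (1 / 2 : ℝ) • (S.contactForm x v • S.J x (Y x) + S.contactForm x (Y x) • S.J x v
        + inner ℝ v (S.J x (Y x)) • S.reeb x) := by
  rw [S.tanakaWebster_apply, hS.leviCivita_reeb, inner_smul_right, S.inner_J_swap x v]
  module

variable {S} in
lemma IsSasakian.inner_tanakaWebster_add (hS : S.IsSasakian) (v : TangentSpace I x)
    (hY : MDiffAt (T% Y) x) (hZ : MDiffAt (T% Z) x) :
    mvfderiv I (fun y ↦ inner ℝ (Y y) (Z y)) x v =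
      inner ℝ (S.tanakaWebster Y x v) (Z x) + inner ℝ (Y x) (S.tanakaWebster Z x v) := by
  have h := inner_leviCivita_add (mdifferentiableAt_extend I E v) hY hZ
  rw [extend_apply_self] at h
  rw [h, hS.tanakaWebster_apply, hS.tanakaWebster_apply]
  simp only [inner_add_left, inner_add_right, inner_smul_left, inner_smul_right,
    S.inner_reeb, S.inner_reeb_right, S.inner_J_left, conj_trivial]
  rw [S.inner_J_swap x (Y x) v]
  ring

variable {S} in
-- D is torsion-free, so only the difference tensor counts: its part θ(X) JY + θ(Y) JX is symmetric
-- and cancels, while ½ g(X, JY) T is antisymmetric and doubles.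
lemma IsSasakian.tanakaWebster_torsion (hS : S.IsSasakian)
    (hX : MDiffAt (T% X) x) (hY : MDiffAt (T% Y) x) :
    S.tanakaWebster Y x (X x) - S.tanakaWebster X x (Y x) - mlieBracket I X Y x =
      inner ℝ (X x) (S.J x (Y x)) • S.reeb x := by
  rw [← leviCivita_torsion_free hX hY, hS.tanakaWebster_apply, hS.tanakaWebster_apply]
  rw [S.inner_J_swap x (Y x)]
  module

lemma trace_J (x : M) : LinearMap.trace ℝ (TangentSpace I x) (S.J x : _ →ₗ[ℝ] _) = 0 := by
  have b := stdOrthonormalBasis ℝ (TangentSpace I x)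
  rw [LinearMap.trace_eq_sum_inner _ b]
  refine Finset.sum_eq_zero fun i _ ↦ ?_
  have := S.inner_J_swap x (b i) (b i)
  simp only [ContinuousLinearMap.coe_coe]
  linarith

variable {S} in
-- Each of the three correction terms is traceless: two have trace ½ θ(JY) = 0, the third is a
-- multiple of the skew map J.
lemma IsSasakian.divergence_eq_trace (hS : S.IsSasakian) (Y : Π x : M, TangentSpace I x) (x : M) :
    divergence Y x = LinearMap.trace ℝ (TangentSpace I x) (S.tanakaWebster Y x : _ →ₗ[ℝ] _) := by
  have h : (S.tanakaWebster Y x : TangentSpace I x →ₗ[ℝ] TangentSpace I x) =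
      (leviCivita I M Y x : TangentSpace I x →ₗ[ℝ] TangentSpace I x)
      + (1 / 2 : ℝ) • ((S.contactForm x : TangentSpace I x →ₗ[ℝ] ℝ).smulRight (S.J x (Y x))
        + S.contactForm x (Y x) • (S.J x : TangentSpace I x →ₗ[ℝ] TangentSpace I x)
        + (innerₗ (TangentSpace I x) (S.J x (Y x))).smulRight (S.reeb x)) := by
    ext v
    simp [hS.tanakaWebster_apply, real_inner_comm]
  rw [h, divergence]
  simp [S.trace_J, LinearMap.trace_smulRight, S.contactForm_J, S.inner_reeb_right]

end PseudohermitianStructure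

/-! ### Smooth functions and fields on open sets, orthonormal frames -/

section SmoothCalculus

variable {E : Type*} [NormedAddCommGroup E] [NormedSpace ℝ E] [FiniteDimensional ℝ E]
  [CompleteSpace E] {H : Type*} [TopologicalSpace H] {I : ModelWithCorners ℝ E H}
  {M : Type*} [TopologicalSpace M] [ChartedSpace H M] [IsManifold I ∞ M]

variable (I) in
/-- A real function which is smooth at every point of `U`. -/
def SmoothFunOn (U : Set M) (f : M → ℝ) : Prop :=
  ∀ y ∈ U, ContMDiffAt I 𝓘(ℝ, ℝ) ∞ f y

/-- A vector field which is smooth at every point of `U`. -/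
def SmoothFieldOn (U : Set M) (X : Π x : M, TangentSpace I x) : Prop :=
  ∀ y ∈ U, CMDiffAt ∞ (T% X) y

/-- The derivative of a function along a vector field. -/
def along (X : Π x : M, TangentSpace I x) (f : M → ℝ) (y : M) : ℝ := mvfderiv I f y (X y)

variable {U : Set M} {f h : M → ℝ} {X Y Z : Π x : M, TangentSpace I x} {x : M}

namespace SmoothFunOn

lemma mdiffAt (hf : SmoothFunOn I U f) (hx : x ∈ U) : MDiffAt f x :=
  (hf x hx).mdifferentiableAt (by simp)

lemma const (c : ℝ) : SmoothFunOn I U (fun _ ↦ c) := fun _ _ ↦ contMDiffAt_const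

lemma add (hf : SmoothFunOn I U f) (hh : SmoothFunOn I U h) :
    SmoothFunOn I U (fun y ↦ f y + h y) := fun y hy ↦ (hf y hy).add (hh y hy)

lemma sub (hf : SmoothFunOn I U f) (hh : SmoothFunOn I U h) :
    SmoothFunOn I U (fun y ↦ f y - h y) := fun y hy ↦ (hf y hy).sub (hh y hy)

lemma mul (hf : SmoothFunOn I U f) (hh : SmoothFunOn I U h) :
    SmoothFunOn I U (fun y ↦ f y * h y) := fun y hy ↦ (hf y hy).mul (hh y hy)

lemma sum {ι : Type*} {s : Finset ι} {F : ι → M → ℝ} (hF : ∀ i ∈ s, SmoothFunOn I U (F i)) :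
    SmoothFunOn I U (fun y ↦ ∑ i ∈ s, F i y) :=
  fun y hy ↦ ContMDiffAt.sum fun i hi ↦ hF i hi y hy

lemma comp {φ : ℝ → ℝ} (hφ : ∀ y ∈ U, ContDiffAt ℝ ∞ φ (f y)) (hf : SmoothFunOn I U f) :
    SmoothFunOn I U (fun y ↦ φ (f y)) :=
  fun y hy ↦ (hφ y hy).contMDiffAt.comp y (hf y hy)

lemma congr (hf : SmoothFunOn I U f) (hU : IsOpen U) (hfh : ∀ y ∈ U, h y = f y) :
    SmoothFunOn I U h :=
  fun y hy ↦ (hf y hy).congr_of_eventuallyEq (Filter.eventually_of_mem (hU.mem_nhds hy) hfh)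

end SmoothFunOn

namespace SmoothFieldOn

lemma mdiffAt (hX : SmoothFieldOn U X) (hx : x ∈ U) : MDiffAt (T% X) x :=
  (hX x hx).mdifferentiableAt (by simp)

lemma add (hX : SmoothFieldOn U X) (hY : SmoothFieldOn U Y) : SmoothFieldOn U (X + Y) :=
  fun y hy ↦ (hX y hy).add_section (hY y hy)

lemma sub (hX : SmoothFieldOn U X) (hY : SmoothFieldOn U Y) : SmoothFieldOn U (X - Y) :=
  fun y hy ↦ (hX y hy).sub_section (hY y hy)

lemma smul (hf : SmoothFunOn I U f) (hX : SmoothFieldOn U X) : SmoothFieldOn U (f • X) :=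
  fun y hy ↦ (hf y hy).smul_section (hX y hy)

lemma sum {ι : Type*} {s : Finset ι} {F : ι → Π x : M, TangentSpace I x}
    (hF : ∀ i ∈ s, SmoothFieldOn U (F i)) : SmoothFieldOn U (fun y ↦ ∑ i ∈ s, F i y) :=
  fun y hy ↦ ContMDiffAt.sum_section fun i hi ↦ hF i hi y hy

lemma congr (hX : SmoothFieldOn U X) (hU : IsOpen U) (hXY : ∀ y ∈ U, Y y = X y) :
    SmoothFieldOn U Y :=
  fun y hy ↦ (hX y hy).congr_of_eventuallyEq <|
    Filter.eventually_of_mem (hU.mem_nhds hy) fun z hz ↦ congrArg (TotalSpace.mk' E z) (hXY z hz)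

lemma mlieBracket (hX : SmoothFieldOn U X) (hY : SmoothFieldOn U Y) :
    SmoothFieldOn U (mlieBracket I X Y) := by
  intro y hy
  have : IsManifold I ((⊤ : ℕ∞) + 1 : WithTop ℕ∞) M := by simpa using ‹IsManifold I ∞ M›
  have h2 : minSmoothness ℝ 2 = 2 := by simp
  have : IsManifold I (minSmoothness ℝ 2) M := by rw [h2]; infer_instance
  exact ContMDiffAt.mlieBracket_vectorField (m := ⊤) (n := ⊤) (hX y hy) (hY y hy) (by simp)

lemma jacobi (hX : SmoothFieldOn U X) (hY : SmoothFieldOn U Y) (hZ : SmoothFieldOn U Z)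
    (hx : x ∈ U) :
    VectorField.mlieBracket I X (VectorField.mlieBracket I Y Z) x =
      VectorField.mlieBracket I (VectorField.mlieBracket I X Y) Z x
        + VectorField.mlieBracket I Y (VectorField.mlieBracket I X Z) x := by
  have h3 : minSmoothness ℝ 3 = 3 := by simp
  have h2 : minSmoothness ℝ 2 = 2 := by simp
  have : IsManifold I (minSmoothness ℝ 3) M := by rw [h3]; infer_instance
  have h : minSmoothness ℝ 2 ≤ ((⊤ : ℕ∞) : WithTop ℕ∞) := by
    rw [h2]; exact ENat.LEInfty.out
  exact leibniz_identity_mlieBracket_apply ((hX x hx).of_le h) ((hY x hx).of_le h)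
    ((hZ x hx).of_le h)

end SmoothFieldOn

lemma mvfderiv_congr_of_eqOn (hU : IsOpen U) (hfh : ∀ y ∈ U, f y = h y) (hx : x ∈ U) :
    mvfderiv I f x = mvfderiv I h x := by
  have : f =ᶠ[nhds x] h := Filter.eventually_of_mem (hU.mem_nhds hx) hfh
  ext v
  simp only [mvfderiv, this.mfderiv_eq]
  rfl

lemma mlieBracket_congr_of_eqOn {X' Y' : Π x : M, TangentSpace I x} (hU : IsOpen U)
    (hX : ∀ y ∈ U, X y = X' y) (hY : ∀ y ∈ U, Y y = Y' y) (hx : x ∈ U) :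
    mlieBracket I X Y x = mlieBracket I X' Y' x :=
  Filter.EventuallyEq.mlieBracket_vectorField_eq
    (Filter.eventually_of_mem (hU.mem_nhds hx) hX) (Filter.eventually_of_mem (hU.mem_nhds hx) hY)

lemma covariantDerivative_congr_of_eqOn
    (cov : CovariantDerivative I E (fun x : M ↦ TangentSpace I x)) (hU : IsOpen U)
    (hX : SmoothFieldOn U X) (hXY : ∀ y ∈ U, X y = Y y) (hx : x ∈ U) : cov X x = cov Y x :=
  cov.isCovariantDerivativeOn.congr_of_eqOn (s := U) (hX.mdiffAt hx)
    ((hX.congr hU fun y hy ↦ (hXY y hy).symm).mdiffAt hx) (hU.mem_nhds hx) hXY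

section Riemannian

variable [RiemannianBundle (fun x : M ↦ TangentSpace I x)]
  [IsContMDiffRiemannianBundle I ∞ E (fun x : M ↦ TangentSpace I x)]

lemma SmoothFieldOn.inner (hX : SmoothFieldOn U X) (hY : SmoothFieldOn U Y) :
    SmoothFunOn I U (fun y ↦ inner ℝ (X y) (Y y)) :=
  fun y hy ↦ ContMDiffAt.inner_bundle (E := fun x : M ↦ TangentSpace I x) (F := E) (b := fun y ↦ y)
    (hX y hy) (hY y hy)

/-- A smooth orthonormal frame of the tangent bundle over an open set. -/
structure IsOrthonormalFrameOn {ι : Type*} (e : ι → Π x : M, TangentSpace I x) (U : Set M) :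
    Prop where
  isOpen : IsOpen U
  smooth : ∀ i, SmoothFieldOn U (e i)
  orthonormal : ∀ y ∈ U, Orthonormal ℝ (fun i ↦ e i y)
  span_eq_top : ∀ y ∈ U, Submodule.span ℝ (range fun i ↦ e i y) = ⊤

/-- Strong induction: each Gram-Schmidt step divides only by squared norms of earlier vectors, which
linear independence keeps away from zero. -/
lemma smoothFieldOn_gramSchmidt {ι : Type*} [LinearOrder ι] [LocallyFiniteOrderBot ι]
    [WellFoundedLT ι] {s : ι → Π x : M, TangentSpace I x} (hs : ∀ i, SmoothFieldOn U (s i))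
    (hli : ∀ y ∈ U, LinearIndependent ℝ (fun i ↦ s i y)) (i : ι) :
    SmoothFieldOn U (fun y ↦ InnerProductSpace.gramSchmidt ℝ (fun j ↦ s j y) i) := by
  induction i using WellFoundedLT.induction with
  | ind i ih =>
  have hinv : ∀ j < i, SmoothFunOn I U (fun y ↦
      (inner ℝ (InnerProductSpace.gramSchmidt ℝ (fun j ↦ s j y) j)
        (InnerProductSpace.gramSchmidt ℝ (fun j ↦ s j y) j))⁻¹) := by
    intro j hj
    refine SmoothFunOn.comp (φ := fun t ↦ t⁻¹) (fun y hy ↦ ?_) ((ih j hj).inner (ih j hj))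
    refine contDiffAt_inv _ ?_
    rw [inner_self_ne_zero]
    exact InnerProductSpace.gramSchmidt_ne_zero _ (hli y hy)
  have : (fun y ↦ InnerProductSpace.gramSchmidt ℝ (fun j ↦ s j y) i) =
      s i - fun y ↦ ∑ j ∈ Finset.Iio i,
        ((fun y ↦ (inner ℝ (InnerProductSpace.gramSchmidt ℝ (fun j ↦ s j y) j) (s i y)) *
          (inner ℝ (InnerProductSpace.gramSchmidt ℝ (fun j ↦ s j y) j)
            (InnerProductSpace.gramSchmidt ℝ (fun j ↦ s j y) j))⁻¹) •
            fun y ↦ InnerProductSpace.gramSchmidt ℝ (fun j ↦ s j y) j) y := by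
    ext y
    rw [InnerProductSpace.gramSchmidt_def]
    simp only [Pi.sub_apply, Submodule.starProjection_singleton, Pi.smul_apply']
    simp [div_eq_mul_inv]
  rw [this]
  refine (hs i).sub (SmoothFieldOn.sum fun j hj ↦ ?_)
  have hj := Finset.mem_Iio.1 hj
  exact SmoothFieldOn.smul (((ih j hj).inner (hs i)).mul (hinv j hj)) (ih j hj)

variable (I) in
lemma exists_orthonormalFrame (x : M) :
    ∃ (U : Set M) (e : Fin (Module.finrank ℝ E) → Π x : M, TangentSpace I x),
      x ∈ U ∧ IsOrthonormalFrameOn e U ∧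
        ∀ v : TangentSpace I x, SmoothFieldOn U (extend E v) := by
  let t := trivializationAt E (fun x : M ↦ TangentSpace I x) x
  let s := t.localFrame (Module.finBasis ℝ E)
  have hs : IsLocalFrameOn I E ((⊤ : ℕ∞) : WithTop ℕ∞) s t.baseSet :=
    t.isLocalFrameOn_localFrame_baseSet I _ (Module.finBasis ℝ E)
  have hsm : ∀ i, SmoothFieldOn t.baseSet (s i) := fun i y hy ↦ hs.contMDiffAt t.open_baseSet hy i
  have hli : ∀ y ∈ t.baseSet, LinearIndependent ℝ (fun i ↦ s i y) :=
    fun y hy ↦ hs.linearIndependent hy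
  refine ⟨t.baseSet, fun i y ↦ InnerProductSpace.gramSchmidtNormed ℝ (fun j ↦ s j y) i,
    FiberBundle.mem_baseSet_trivializationAt' x, ⟨t.open_baseSet, fun i ↦ ?_, fun y hy ↦ ?_,
      fun y hy ↦ ?_⟩, fun v y hy ↦ ?_⟩
  · have hg := smoothFieldOn_gramSchmidt hsm hli i
    have hn : SmoothFunOn I t.baseSet
        (fun y ↦ ‖InnerProductSpace.gramSchmidt ℝ (fun j ↦ s j y) i‖⁻¹) := by
      have h1 : (fun y ↦ ‖InnerProductSpace.gramSchmidt ℝ (fun j ↦ s j y) i‖⁻¹) =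
          fun y ↦ (√(inner ℝ (InnerProductSpace.gramSchmidt ℝ (fun j ↦ s j y) i)
            (InnerProductSpace.gramSchmidt ℝ (fun j ↦ s j y) i)))⁻¹ := by
        ext y
        rw [norm_eq_sqrt_real_inner]
      rw [h1]
      refine SmoothFunOn.comp (φ := fun t ↦ (√t)⁻¹) (fun y hy ↦ ?_) (hg.inner hg)
      have h2 : 0 < inner ℝ (InnerProductSpace.gramSchmidt ℝ (fun j ↦ s j y) i)
          (InnerProductSpace.gramSchmidt ℝ (fun j ↦ s j y) i) :=
        real_inner_self_pos.2 (InnerProductSpace.gramSchmidt_ne_zero _ (hli y hy))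
      exact (Real.contDiffAt_sqrt h2.ne').inv (Real.sqrt_pos.2 h2).ne'
    exact SmoothFieldOn.smul hn hg
  · exact InnerProductSpace.gramSchmidtNormed_orthonormal (hli y hy)
  · have h := InnerProductSpace.span_gramSchmidtNormed_range (𝕜 := ℝ) (fun j ↦ s j y)
    rw [InnerProductSpace.span_gramSchmidt] at h
    exact h.trans (top_le_iff.1 (hs.generating hy))
  -- `extend E v` has constant coordinates in the trivialization at x, so it is smooth on the whole
  -- base set.
  · have : CMDiff[t.baseSet] ((⊤ : ℕ∞) : WithTop ℕ∞) (T% (extend E v)) := by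
      intro y hy
      rw [t.contMDiffWithinAt_section _ hy]
      have : CMDiff[t.baseSet] ((⊤ : ℕ∞) : WithTop ℕ∞) (fun _ : M ↦ (t ⟨x, v⟩).2) :=
        contMDiffOn_const
      refine this.congr (fun z hz ↦ ?_) y hy
      change (t ⟨z, t.symm z (t ⟨x, v⟩).2⟩).2 = _
      rw [t.apply_mk_symm hz]
    exact this.contMDiffAt (t.open_baseSet.mem_nhds hy)

namespace IsOrthonormalFrameOn

variable {ι : Type*} [Fintype ι] {e : ι → Π x : M, TangentSpace I x}

/-- The orthonormal basis of a tangent space given by an orthonormal frame. -/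
def basis (he : IsOrthonormalFrameOn e U) (hx : x ∈ U) :
    OrthonormalBasis ι ℝ (TangentSpace I x) :=
  OrthonormalBasis.mk (he.orthonormal x hx) (he.span_eq_top x hx).ge

@[simp]
lemma basis_apply (he : IsOrthonormalFrameOn e U) (hx : x ∈ U) (i : ι) :
    he.basis hx i = e i x := by
  simp [basis]

lemma sum_inner_smul (he : IsOrthonormalFrameOn e U) (hx : x ∈ U) (v : TangentSpace I x) :
    ∑ i, inner ℝ (e i x) v • e i x = v := by
  simpa using (he.basis hx).sum_repr' v

lemma trace_eq (he : IsOrthonormalFrameOn e U) (hx : x ∈ U)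
    (A : TangentSpace I x →ₗ[ℝ] TangentSpace I x) :
    LinearMap.trace ℝ (TangentSpace I x) A = ∑ i, inner ℝ (e i x) (A (e i x)) := by
  simpa using LinearMap.trace_eq_sum_inner A (he.basis hx)

lemma sum_inner_mul_inner (he : IsOrthonormalFrameOn e U) (hx : x ∈ U) (v w : TangentSpace I x) :
    ∑ i, inner ℝ (e i x) v * inner ℝ (e i x) w = inner ℝ v w := by
  simpa [real_inner_comm] using (he.basis hx).sum_inner_mul_inner v w

lemma smoothFieldOn_of_inner (he : IsOrthonormalFrameOn e U)
    (hX : ∀ i, SmoothFunOn I U (fun y ↦ inner ℝ (e i y) (X y))) : SmoothFieldOn U X :=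
  (SmoothFieldOn.sum (s := Finset.univ) fun i _ ↦ (SmoothFieldOn.smul (hX i) (he.smooth i))).congr
    he.isOpen fun _ hy ↦ (he.sum_inner_smul hy _).symm

end IsOrthonormalFrameOn

/-! ### Derivatives along fields through Lie brackets, smoothness of the connections -/

namespace PseudohermitianStructure

variable (S : PseudohermitianStructure I M)

lemma smooth_reeb : SmoothFieldOn U S.reeb := fun y _ ↦ S.contMDiff_reeb y

lemma smooth_J (hX : SmoothFieldOn U X) : SmoothFieldOn U (fun y ↦ S.J y (X y)) := fun y hy ↦
  ContMDiffAt.clm_bundle_apply (E₁ := fun x : M ↦ TangentSpace I x)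
    (E₂ := fun x : M ↦ TangentSpace I x) (b := fun y ↦ y) (S.contMDiff_J y) (hX y hy)

lemma smooth_contactForm (hX : SmoothFieldOn U X) :
    SmoothFunOn I U (fun y ↦ S.contactForm y (X y)) := by
  simpa only [S.inner_reeb] using S.smooth_reeb.inner hX

/-- Since θ(T) = 1, the Leibniz rule for [X, fT] isolates Xf. Smoothness of Xf and the commutator
rule below are thus inherited from the Lie bracket of fields. -/
lemma along_eq_inner_mlieBracket (hf : SmoothFunOn I U f) (hx : x ∈ U) :
    along X f x = S.contactForm x (mlieBracket I X (f • S.reeb) x)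
      - f x * S.contactForm x (mlieBracket I X S.reeb x) := by
  rw [mlieBracket_smul_right (hf.mdiffAt hx) S.mdiffAt_reeb]
  simp [along, S.contactForm_reeb]

lemma smooth_along (S : PseudohermitianStructure I M) (hU : IsOpen U) (hX : SmoothFieldOn U X)
    (hf : SmoothFunOn I U f) :
    SmoothFunOn I U (along X f) :=
  SmoothFunOn.congr ((S.smooth_contactForm (hX.mlieBracket (SmoothFieldOn.smul hf
    S.smooth_reeb))).sub (hf.mul (S.smooth_contactForm (hX.mlieBracket S.smooth_reeb)))) hU
    fun _ hy ↦ S.along_eq_inner_mlieBracket hf hy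

lemma along_mlieBracket (S : PseudohermitianStructure I M) (hU : IsOpen U)
    (hX : SmoothFieldOn U X) (hY : SmoothFieldOn U Y) (hf : SmoothFunOn I U f) (hx : x ∈ U) :
    along (mlieBracket I X Y) f x = along X (along Y f) x - along Y (along X f) x := by
  have hT : SmoothFieldOn U S.reeb := S.smooth_reeb
  have key : ∀ {V W : Π x : M, TangentSpace I x}, SmoothFieldOn U V → SmoothFieldOn U W →
      mlieBracket I V (mlieBracket I W (f • S.reeb)) x =
        along V (along W f) x • S.reeb x + along W f x • mlieBracket I V S.reeb x
        + along V f x • mlieBracket I W S.reeb x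
        + f x • mlieBracket I V (mlieBracket I W S.reeb) x := by
    intro V W hV hW
    have h1 : mlieBracket I V (mlieBracket I W (f • S.reeb)) x =
        mlieBracket I V (along W f • S.reeb + f • mlieBracket I W S.reeb) x := by
      refine mlieBracket_congr_of_eqOn hU (fun _ _ ↦ rfl) (fun y hy ↦ ?_) hx
      rw [mlieBracket_smul_right (hf.mdiffAt hy) S.mdiffAt_reeb]
      rfl
    have h2 := S.smooth_along hU hW hf
    rw [h1, mlieBracket_add_right ((SmoothFieldOn.smul h2 hT).mdiffAt hx)
      ((SmoothFieldOn.smul hf (hW.mlieBracket hT)).mdiffAt hx),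
      mlieBracket_smul_right (h2.mdiffAt hx) S.mdiffAt_reeb,
      mlieBracket_smul_right (hf.mdiffAt hx) ((hW.mlieBracket hT).mdiffAt hx)]
    simp only [along]
    module
  -- Jacobi for X, Y, fT. The terms with one derivative on f are symmetric in X and Y, those with
  -- none cancel by Jacobi for X, Y, T, and θ reads off the coefficient of T.
  have hJ := hX.jacobi hY (SmoothFieldOn.smul hf hT) hx
  rw [key hX hY, key hY hX, mlieBracket_smul_right (hf.mdiffAt hx) S.mdiffAt_reeb,
    hX.jacobi hY hT hx] at hJ
  have h := congrArg (S.contactForm x) hJ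
  simp only [map_add, map_smul, S.contactForm_reeb, smul_eq_mul] at h
  simp only [along] at h ⊢
  linarith

lemma _root_.CRGeometry.IsOrthonormalFrameOn.smooth_leviCivita (S : PseudohermitianStructure I M)
    {ι : Type*} [Fintype ι] {e : ι → Π x : M, TangentSpace I x}
    (he : IsOrthonormalFrameOn e U) (hX : SmoothFieldOn U X) (hY : SmoothFieldOn U Y) :
    SmoothFieldOn U (fun y ↦ leviCivita I M Y y (X y)) := by
  refine he.smoothFieldOn_of_inner fun i ↦ ?_
  have hi := he.smooth i
  have h : SmoothFunOn I U (koszul X Y (e i)) :=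
    (SmoothFunOn.const (1 / 2)).mul
      ((((((S.smooth_along he.isOpen hX (hY.inner hi)).add
        (S.smooth_along he.isOpen hY (hX.inner hi))).sub
        (S.smooth_along he.isOpen hi (hX.inner hY))).add
        ((hX.mlieBracket hY).inner hi)).sub ((hX.mlieBracket hi).inner hY)).sub
        ((hY.mlieBracket hi).inner hX))
  refine h.congr he.isOpen fun y hy ↦ ?_
  rw [real_inner_comm, inner_leviCivita_eq_koszul (hX.mdiffAt hy) (hY.mdiffAt hy) (hi.mdiffAt hy)]

lemma smooth_tanakaWebster {ι : Type*} [Fintype ι] {e : ι → Π x : M, TangentSpace I x}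
    (he : IsOrthonormalFrameOn e U) (hX : SmoothFieldOn U X) (hY : SmoothFieldOn U Y) :
    SmoothFieldOn U (fun y ↦ S.tanakaWebster Y y (X y)) := by
  have hT := he.smooth_leviCivita S hX S.smooth_reeb
  simp only [S.tanakaWebster_apply]
  exact (he.smooth_leviCivita S hX hY).add
    (((SmoothFieldOn.smul ((SmoothFunOn.const (1 / 2)).mul (S.smooth_contactForm hX))
      (S.smooth_J hY)).sub (SmoothFieldOn.smul (S.smooth_contactForm hY) hT)).add
      (SmoothFieldOn.smul (hY.inner hT) S.smooth_reeb))

end PseudohermitianStructure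

end Riemannian

end SmoothCalculus

section SasakianBochner

variable {E : Type*} [NormedAddCommGroup E] [NormedSpace ℝ E] [FiniteDimensional ℝ E]
  [CompleteSpace E] {H : Type*} [TopologicalSpace H] {I : ModelWithCorners ℝ E H}
  {M : Type*} [TopologicalSpace M] [ChartedSpace H M] [IsManifold I ∞ M]
  [RiemannianBundle (fun x : M ↦ TangentSpace I x)]
  [IsContMDiffRiemannianBundle I ∞ E (fun x : M ↦ TangentSpace I x)]
  {U : Set M} {f h : M → ℝ} {X Y Z V W : Π x : M, TangentSpace I x} {x : M}

/-! ### Divergence, gradient and constant-coefficient extensions -/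

section Divergence

lemma divergence_add (hX : MDiffAt (T% X) x) (hY : MDiffAt (T% Y) x) :
    divergence (X + Y) x = divergence X x + divergence Y x := by
  rw [divergence, (leviCivita I M).isCovariantDerivativeOn.add hX hY, divergence, divergence,
    ← map_add]
  rfl

lemma divergence_smul (hf : MDiffAt f x) (hX : MDiffAt (T% X) x) :
    divergence (f • X) x = f x * divergence X x + along X f x := by
  have h : ((leviCivita I M) (f • X) x : TangentSpace I x →ₗ[ℝ] TangentSpace I x) =
      f x • (leviCivita I M X x : TangentSpace I x →ₗ[ℝ] TangentSpace I x)
      + (mvfderiv I f x : TangentSpace I x →ₗ[ℝ] ℝ).smulRight (X x) := by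
    rw [(leviCivita I M).isCovariantDerivativeOn.leibniz hX hf]
    rfl
  rw [divergence, h, map_add, map_smul, LinearMap.trace_smulRight]
  rfl

lemma divergence_const_smul (c : ℝ) (hX : MDiffAt (T% X) x) :
    divergence (c • X) x = c * divergence X x := by
  have h := divergence_smul (f := fun _ ↦ c) mdifferentiableAt_const hX
  rw [along, mvfderiv_const] at h
  simpa using! h

lemma IsOrthonormalFrameOn.divergence_eq {ι : Type*} [Fintype ι]
    {e : ι → Π x : M, TangentSpace I x} (he : IsOrthonormalFrameOn e U) (hx : x ∈ U) :
    divergence X x = ∑ i, inner ℝ (e i x) (leviCivita I M X x (e i x)) := by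
  rw [divergence, he.trace_eq hx]
  rfl

lemma inner_riemannianGradient (f : M → ℝ) (x : M) (v : TangentSpace I x) :
    inner ℝ (riemannianGradient f x) v = mvfderiv I f x v := by
  simp [riemannianGradient]

/-- The extension of a tangent vector with constant coefficients in an orthonormal frame. -/
def frameExtend {ι : Type*} [Fintype ι] (e : ι → Π x : M, TangentSpace I x)
    (v : TangentSpace I x) (y : M) : TangentSpace I y :=
  ∑ i, inner ℝ (e i x) v • e i y

lemma IsOrthonormalFrameOn.frameExtend_self {ι : Type*} [Fintype ι]
    {e : ι → Π x : M, TangentSpace I x} (he : IsOrthonormalFrameOn e U) (hx : x ∈ U)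
    (v : TangentSpace I x) : frameExtend e v x = v :=
  he.sum_inner_smul hx v

lemma IsOrthonormalFrameOn.smooth_frameExtend {ι : Type*} [Fintype ι]
    {e : ι → Π x : M, TangentSpace I x} (he : IsOrthonormalFrameOn e U)
    (v : TangentSpace I x) : SmoothFieldOn U (frameExtend e v) :=
  SmoothFieldOn.sum fun i _ ↦ SmoothFieldOn.smul (SmoothFunOn.const _) (he.smooth i)

end Divergence

/-! ### The horizontal Hessian and its asymmetry -/

namespace PseudohermitianStructure

variable (S : PseudohermitianStructure I M) {ι : Type*} [Fintype ι]
  {e : ι → Π x : M, TangentSpace I x}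

lemma inner_horizontalGradient (f : M → ℝ) (x : M) (v : TangentSpace I x) :
    inner ℝ (S.horizontalGradient f x) v =
      mvfderiv I f x v - S.contactForm x v * mvfderiv I f x (S.reeb x) := by
  rw [horizontalGradient, inner_sub_left, inner_smul_left, inner_riemannianGradient,
    S.inner_reeb, ← S.inner_reeb_right, inner_riemannianGradient]
  simp [mul_comm]

lemma contactForm_horizontalGradient (f : M → ℝ) (x : M) :
    S.contactForm x (S.horizontalGradient f x) = 0 := by
  rw [← S.inner_reeb_right, inner_horizontalGradient, S.contactForm_reeb]
  ring

lemma smooth_horizontalGradient (he : IsOrthonormalFrameOn e U) (hf : SmoothFunOn I U f) :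
    SmoothFieldOn U (S.horizontalGradient f) := by
  refine he.smoothFieldOn_of_inner fun i ↦ ?_
  simp only [real_inner_comm (S.horizontalGradient f _), inner_horizontalGradient]
  exact (S.smooth_along he.isOpen (he.smooth i) hf).sub ((S.smooth_contactForm (he.smooth i)).mul
    (S.smooth_along he.isOpen S.smooth_reeb hf))

lemma smooth_subLaplacian (he : IsOrthonormalFrameOn e U) (hf : SmoothFunOn I U f) :
    SmoothFunOn I U (S.subLaplacian f) := by
  have hZ := S.smooth_horizontalGradient he hf
  refine (SmoothFunOn.sum (s := Finset.univ) fun i _ ↦ (he.smooth i).inner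
    (he.smooth_leviCivita S (he.smooth i) hZ)).congr he.isOpen fun y hy ↦ ?_
  exact he.divergence_eq hy

variable {S}

namespace IsSasakian

lemma contactForm_tanakaWebster (hS : S.IsSasakian) (hX : MDiffAt (T% X) x) (v : TangentSpace I x) :
    S.contactForm x (S.tanakaWebster X x v) =
      mvfderiv I (fun y ↦ S.contactForm y (X y)) x v := by
  have h := hS.inner_tanakaWebster_add v S.mdiffAt_reeb hX
  simp only [S.inner_reeb, S.tanakaWebster_reeb, inner_zero_left, zero_add] at h
  exact h.symm

lemma contactForm_tanakaWebster_of_horizontal (hS : S.IsSasakian) (hX : MDiffAt (T% X) x)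
    (hX0 : ∀ y, S.contactForm y (X y) = 0) (v : TangentSpace I x) :
    S.contactForm x (S.tanakaWebster X x v) = 0 := by
  rw [hS.contactForm_tanakaWebster hX, funext hX0, mvfderiv_const]
  rfl

/-- Differentiate g(∇_H f, W) = Wf - θ(W) Tf with the metric connection. -/
lemma inner_tanakaWebster_horizontalGradient (hS : S.IsSasakian) (he : IsOrthonormalFrameOn e U)
    (hf : SmoothFunOn I U f) (hW : SmoothFieldOn U W) (hx : x ∈ U) (v : TangentSpace I x) :
    inner ℝ (S.tanakaWebster (S.horizontalGradient f) x v) (W x) =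
      mvfderiv I (along W f) x v - mvfderiv I f x (S.tanakaWebster W x v)
        - S.contactForm x (W x) * mvfderiv I (along S.reeb f) x v := by
  have hZ := S.smooth_horizontalGradient he hf
  have h := hS.inner_tanakaWebster_add v (hZ.mdiffAt hx) (hW.mdiffAt hx)
  have h1 : (fun y ↦ inner ℝ (S.horizontalGradient f y) (W y)) =
      fun y ↦ along W f y - S.contactForm y (W y) * along S.reeb f y := by
    ext y
    rw [inner_horizontalGradient]
    rfl
  have hWf := S.smooth_along he.isOpen hW hf
  have hTf := S.smooth_along he.isOpen S.smooth_reeb hf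
  have hθ := S.smooth_contactForm hW
  rw [h1, mvfderiv_fun_sub (hWf.mdiffAt hx) ((hθ.mul hTf).mdiffAt hx),
    mvfderiv_fun_mul (hθ.mdiffAt hx) (hTf.mdiffAt hx), inner_horizontalGradient,
    hS.contactForm_tanakaWebster (hW.mdiffAt hx)] at h
  simp only [sub_apply, add_apply, smul_apply, smul_eq_mul, along] at h ⊢
  linarith

/-- The second derivatives of f combine to [V, W]f, and [V, W]f - (∇_V W - ∇_W V)f is minus the
torsion applied to f, which gives the first term. The other two come from projecting the gradient
off T. -/
lemma tanakaWebster_horizontalGradient_sub (hS : S.IsSasakian) (he : IsOrthonormalFrameOn e U)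
    (hf : SmoothFunOn I U f) (hx : x ∈ U) (v w : TangentSpace I x) :
    inner ℝ (S.tanakaWebster (S.horizontalGradient f) x v) w
      - inner ℝ (S.tanakaWebster (S.horizontalGradient f) x w) v =
      - inner ℝ v (S.J x w) * along S.reeb f x
        - S.contactForm x w * mvfderiv I (along S.reeb f) x v
        + S.contactForm x v * mvfderiv I (along S.reeb f) x w := by
  have hV := he.smooth_frameExtend v
  have hW := he.smooth_frameExtend w
  have h1 := hS.inner_tanakaWebster_horizontalGradient he hf hV hx w
  have h2 := hS.inner_tanakaWebster_horizontalGradient he hf hW hx v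
  have h3 := hS.tanakaWebster_torsion (hV.mdiffAt hx) (hW.mdiffAt hx)
  have h4 := S.along_mlieBracket he.isOpen hV hW hf hx
  have h5 := congrArg (mvfderiv I f x) h3
  simp only [along, he.frameExtend_self hx, map_sub, map_smul, smul_eq_mul] at *
  linarith

lemma tanakaWebster_reeb_horizontalGradient (hS : S.IsSasakian) (he : IsOrthonormalFrameOn e U)
    (hf : SmoothFunOn I U f) (hx : x ∈ U) :
    S.tanakaWebster (S.horizontalGradient f) x (S.reeb x) =
      S.horizontalGradient (along S.reeb f) x := by
  refine ext_inner_right ℝ fun w ↦ ?_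
  have h := hS.tanakaWebster_horizontalGradient_sub he hf hx (S.reeb x) w
  rw [S.inner_reeb_right, hS.contactForm_tanakaWebster_of_horizontal
    ((S.smooth_horizontalGradient he hf).mdiffAt hx) (S.contactForm_horizontalGradient f),
    S.inner_reeb, S.contactForm_J, S.contactForm_reeb] at h
  rw [inner_horizontalGradient]
  linarith

/-- The differential of |Z|² is w ↦ 2 g(∇_w Z, Z). Exchanging w and Z by the asymmetry formula costs
the torsion term τ JZ; the leftover θ(w) Zτ is exactly the vertical part removed by the projection.
-/
lemma horizontalGradient_inner_self (hS : S.IsSasakian) (he : IsOrthonormalFrameOn e U)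
    (hf : SmoothFunOn I U f) (hx : x ∈ U) :
    S.horizontalGradient
      (fun y ↦ inner ℝ (S.horizontalGradient f y) (S.horizontalGradient f y)) x =
      (2 : ℝ) • (S.tanakaWebster (S.horizontalGradient f) x (S.horizontalGradient f x)
        - along S.reeb f x • S.J x (S.horizontalGradient f x)) := by
  have hZ := (S.smooth_horizontalGradient he hf).mdiffAt hx
  have hd : ∀ v : TangentSpace I x, mvfderiv I
      (fun y ↦ inner ℝ (S.horizontalGradient f y) (S.horizontalGradient f y)) x v =
      2 * inner ℝ (S.tanakaWebster (S.horizontalGradient f) x v) (S.horizontalGradient f x) := by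
    intro v
    rw [hS.inner_tanakaWebster_add v hZ hZ, real_inner_comm (S.horizontalGradient f x)]
    rw [real_inner_comm]
    ring
  refine ext_inner_right ℝ fun w ↦ ?_
  have h1 := hS.tanakaWebster_horizontalGradient_sub he hf hx w (S.horizontalGradient f x)
  rw [S.contactForm_horizontalGradient] at h1
  rw [inner_horizontalGradient, hd, hd, hS.tanakaWebster_reeb_horizontalGradient he hf hx,
    inner_horizontalGradient, S.contactForm_horizontalGradient, inner_smul_left, inner_sub_left,
    inner_smul_left, S.inner_J_left, S.inner_J_swap x _ w]
  simp only [conj_trivial]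
  linarith

end IsSasakian

end PseudohermitianStructure

/-! ### Traces in moving frames, and commutation of T with L -/

namespace IsOrthonormalFrameOn

variable {ι : Type*} [Fintype ι] {e : ι → Π x : M, TangentSpace I x}

/-- The sum is the change of tr N when the frame turns with velocity w. A skew velocity is an
infinitesimal rotation, under which the trace is invariant. This disposes of derivatives of the
frame, so no frame adapted to x is needed. -/
lemma sum_skew_eq_zero (he : IsOrthonormalFrameOn e U) (hx : x ∈ U) (w : ι → TangentSpace I x)
    (hw : ∀ i j, inner ℝ (w i) (e j x) + inner ℝ (e i x) (w j) = 0)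
    (N : TangentSpace I x →ₗ[ℝ] TangentSpace I x) :
    ∑ i, (inner ℝ (w i) (N (e i x)) + inner ℝ (e i x) (N (w i))) = 0 := by
  have h1 : ∀ i, inner ℝ (w i) (N (e i x)) =
      ∑ j, inner ℝ (e j x) (w i) * inner ℝ (e j x) (N (e i x)) :=
    fun i ↦ (he.sum_inner_mul_inner hx _ _).symm
  have h2 : ∀ i, inner ℝ (e i x) (N (w i)) =
      ∑ j, inner ℝ (e j x) (w i) * inner ℝ (e i x) (N (e j x)) := by
    intro i
    conv_lhs => rw [← he.sum_inner_smul hx (w i)]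
    simp [inner_sum, inner_smul_right]
  rw [Finset.sum_add_distrib, Finset.sum_congr rfl fun i _ ↦ h1 i,
    Finset.sum_congr rfl fun i _ ↦ h2 i, Finset.sum_comm, ← Finset.sum_add_distrib]
  refine Finset.sum_eq_zero fun i _ ↦ ?_
  rw [← Finset.sum_add_distrib]
  refine Finset.sum_eq_zero fun j _ ↦ ?_
  have := hw j i
  rw [real_inner_comm] at this
  linear_combination inner ℝ (e i x) (N (e j x)) * this

lemma inner_eqOn (he : IsOrthonormalFrameOn e U) (i j : ι) :
    ∃ c : ℝ, ∀ y ∈ U, inner ℝ (e i y) (e j y) = c := by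
  classical
  exact ⟨if i = j then 1 else 0, fun y hy ↦ orthonormal_iff_ite.1 (he.orthonormal y hy) i j⟩

lemma mvfderiv_inner_eq_zero (he : IsOrthonormalFrameOn e U) (hx : x ∈ U) (i j : ι) :
    mvfderiv I (fun y ↦ inner ℝ (e i y) (e j y)) x = 0 := by
  obtain ⟨c, hc⟩ := he.inner_eqOn i j
  rw [mvfderiv_congr_of_eqOn he.isOpen hc hx, mvfderiv_const]

end IsOrthonormalFrameOn

lemma mvfderiv_fun_sum {ι : Type*} (s : Finset ι) {F : ι → M → ℝ}
    (hF : ∀ i, SmoothFunOn I U (F i)) (hx : x ∈ U) (v : TangentSpace I x) :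
    mvfderiv I (fun y ↦ ∑ i ∈ s, F i y) x v = ∑ i ∈ s, mvfderiv I (F i) x v := by
  classical
  induction s using Finset.induction_on with
  | empty => simp [mvfderiv_const]
  | insert a s ha ih =>
    simp only [Finset.sum_insert ha]
    rw [mvfderiv_fun_add ((hF a).mdiffAt hx) ((SmoothFunOn.sum fun i _ ↦ hF i).mdiffAt hx),
      add_apply, ih]

namespace PseudohermitianStructure

variable {S : PseudohermitianStructure I M} {ι : Type*} [Fintype ι]
  {e : ι → Π x : M, TangentSpace I x}

namespace IsSasakian

lemma divergence_eq_sum (hS : S.IsSasakian) (he : IsOrthonormalFrameOn e U) (hx : x ∈ U)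
    (X : Π x : M, TangentSpace I x) :
    divergence X x = ∑ i, inner ℝ (e i x) (S.tanakaWebster X x (e i x)) := by
  rw [hS.divergence_eq_trace, he.trace_eq hx]
  rfl

lemma tanakaWebster_frame_skew (hS : S.IsSasakian) (he : IsOrthonormalFrameOn e U) (hx : x ∈ U)
    (v : TangentSpace I x) (i j : ι) :
    inner ℝ (S.tanakaWebster (e i) x v) (e j x) + inner ℝ (e i x) (S.tanakaWebster (e j) x v)
      = 0 := by
  rw [← hS.inner_tanakaWebster_add v ((he.smooth i).mdiffAt hx) ((he.smooth j).mdiffAt hx),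
    he.mvfderiv_inner_eq_zero hx]
  rfl

lemma mvfderiv_divergence (hS : S.IsSasakian) (he : IsOrthonormalFrameOn e U) (hx : x ∈ U)
    (hZ : SmoothFieldOn U Z) (v : TangentSpace I x) :
    mvfderiv I (divergence Z) x v =
      ∑ i, (inner ℝ (S.tanakaWebster (e i) x v) (S.tanakaWebster Z x (e i x))
        + inner ℝ (e i x) (S.tanakaWebster (fun y ↦ S.tanakaWebster Z y (e i y)) x v)) := by
  have hs := fun i ↦ S.smooth_tanakaWebster he (he.smooth i) hZ
  rw [mvfderiv_congr_of_eqOn he.isOpen (fun y hy ↦ hS.divergence_eq_sum he hy Z) hx,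
    mvfderiv_fun_sum _ (fun i ↦ (he.smooth i).inner (hs i)) hx]
  exact Finset.sum_congr rfl fun i _ ↦
    hS.inner_tanakaWebster_add v ((he.smooth i).mdiffAt hx) ((hs i).mdiffAt hx)

/-- Commute ∇_{e_i} with ∇_V under the trace. The bracket [e_i, V] contributes ∇_{e_i} V, a torsion
term that sums to g(∇_T Z, JV), and ∇_V e_i; the latter cancels against the frame derivatives in
V(div Z) by skewness. -/
lemma divergence_tanakaWebster (hS : S.IsSasakian) (he : IsOrthonormalFrameOn e U) (hx : x ∈ U)
    (hV : SmoothFieldOn U V) (hZ : SmoothFieldOn U Z) :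
    divergence (fun y ↦ S.tanakaWebster Z y (V y)) x =
      ∑ i, inner ℝ (e i x) (curvature S.tanakaWebster (e i) V Z x)
        + along V (divergence Z) x
        + ∑ i, inner ℝ (e i x) (S.tanakaWebster Z x (S.tanakaWebster V x (e i x)))
        - inner ℝ (S.tanakaWebster Z x (S.reeb x)) (S.J x (V x)) := by
  have hskew := he.sum_skew_eq_zero hx _ (hS.tanakaWebster_frame_skew he hx (V x))
    (S.tanakaWebster Z x)
  rw [hS.divergence_eq_sum he hx, along, hS.mvfderiv_divergence he hx hZ,
    ← he.sum_inner_mul_inner hx (S.tanakaWebster Z x (S.reeb x)), ← Finset.sum_add_distrib,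
    ← Finset.sum_add_distrib, ← Finset.sum_sub_distrib, ← sub_eq_zero, ← Finset.sum_sub_distrib,
    ← neg_eq_zero, ← Finset.sum_neg_distrib, ← hskew]
  refine Finset.sum_congr rfl fun i _ ↦ ?_
  have h := hS.tanakaWebster_torsion ((he.smooth i).mdiffAt hx) (hV.mdiffAt hx)
  have h2 : mlieBracket I (e i) V x = S.tanakaWebster V x (e i x) - S.tanakaWebster (e i) x (V x)
      - inner ℝ (e i x) (S.J x (V x)) • S.reeb x := by
    rw [← h]; module
  rw [curvature, h2]
  simp only [map_sub, map_smul, inner_sub_right, inner_smul_right, ContinuousLinearMap.coe_coe]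
  ring

lemma mlieBracket_reeb (hS : S.IsSasakian) (hX : MDiffAt (T% X) x) :
    mlieBracket I S.reeb X x = S.tanakaWebster X x (S.reeb x) := by
  have h := hS.tanakaWebster_torsion S.mdiffAt_reeb hX
  rw [S.tanakaWebster_reeb, S.inner_reeb, S.contactForm_J, zero_smul, sub_zero, sub_eq_zero] at h
  exact h.symm

lemma mlieBracket_eq (hS : S.IsSasakian) (hX : MDiffAt (T% X) x) (hY : MDiffAt (T% Y) x) :
    mlieBracket I X Y x = S.tanakaWebster Y x (X x) - S.tanakaWebster X x (Y x)
      - inner ℝ (X x) (S.J x (Y x)) • S.reeb x := by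
  rw [← hS.tanakaWebster_torsion hX hY]; module

/-- Replacing ∇_{e_i} Y by [e_i, Y] changes nothing in the sum: ∇_Y e_i is orthogonal to e_i, and
the torsion terms add up to θ(JY) = 0. -/
lemma divergence_eq_sum_mlieBracket (hS : S.IsSasakian) (he : IsOrthonormalFrameOn e U)
    (hx : x ∈ U) (hY : SmoothFieldOn U Y) :
    divergence Y x = ∑ i, inner ℝ (e i x) (mlieBracket I (e i) Y x) := by
  have h0 : ∑ i, inner ℝ (e i x) (S.J x (Y x)) * inner ℝ (e i x) (S.reeb x) = 0 := by
    rw [he.sum_inner_mul_inner hx, S.inner_reeb_right, S.contactForm_J]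
  rw [hS.divergence_eq_sum he hx, ← sub_eq_zero, ← Finset.sum_sub_distrib, ← h0]
  refine Finset.sum_congr rfl fun i _ ↦ ?_
  have h := hS.tanakaWebster_frame_skew he hx (Y x) i i
  rw [real_inner_comm] at h
  rw [hS.mlieBracket_eq ((he.smooth i).mdiffAt hx) (hY.mdiffAt hx)]
  simp only [inner_sub_right, inner_smul_right]
  linarith

/-- The reason is that T is Killing, so its flow preserves the volume. In the frame, Jacobi expands
[T, [e_i, Y]], and the terms in [T, e_i] = ∇_T e_i vanish because the frame only rotates. -/
lemma divergence_mlieBracket_reeb (hS : S.IsSasakian) (he : IsOrthonormalFrameOn e U)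
    (hx : x ∈ U) (hY : SmoothFieldOn U Y) :
    divergence (mlieBracket I S.reeb Y) x = along S.reeb (divergence Y) x := by
  have hT : SmoothFieldOn U S.reeb := S.smooth_reeb
  have hw := fun i ↦ hT.mlieBracket (he.smooth i)
  have hwT : ∀ i, ∀ y ∈ U, mlieBracket I S.reeb (e i) y = S.tanakaWebster (e i) y (S.reeb y) :=
    fun i y hy ↦ hS.mlieBracket_reeb ((he.smooth i).mdiffAt hy)
  have hs := fun i ↦ (he.smooth i).mlieBracket hY
  -- The endomorphism is chosen so that [X, Y] is its value at X minus ∇_Y X.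
  have hskew := he.sum_skew_eq_zero hx _ (hS.tanakaWebster_frame_skew he hx (S.reeb x))
    ((S.tanakaWebster Y x : TangentSpace I x →ₗ[ℝ] TangentSpace I x)
      - (innerₗ (TangentSpace I x) (S.J x (Y x))).smulRight (S.reeb x))
  rw [hS.divergence_eq_sum_mlieBracket he hx (hT.mlieBracket hY), along,
    mvfderiv_congr_of_eqOn he.isOpen (fun y hy ↦ hS.divergence_eq_sum_mlieBracket he hy hY) hx,
    mvfderiv_fun_sum _ (fun i ↦ (he.smooth i).inner (hs i)) hx, eq_comm, ← sub_eq_zero,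
    ← Finset.sum_sub_distrib, ← hskew]
  refine Finset.sum_congr rfl fun i _ ↦ ?_
  -- The function is half of T|e_i|², hence zero on U, so its derivative along Y vanishes too.
  have h0 : mvfderiv I (fun y ↦ inner ℝ (mlieBracket I S.reeb (e i) y) (e i y)) x = 0 := by
    rw [mvfderiv_congr_of_eqOn he.isOpen (h := fun _ ↦ 0) (fun y hy ↦ ?_) hx, mvfderiv_const]
    rw [hwT i y hy]
    have h := hS.tanakaWebster_frame_skew he hy (S.reeb y) i i
    rw [real_inner_comm] at h
    rw [real_inner_comm]
    linarith
  have h1 := congrArg (fun A ↦ A (Y x)) h0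
  simp only [hS.inner_tanakaWebster_add (Y x) ((hw i).mdiffAt hx) ((he.smooth i).mdiffAt hx),
    zero_apply] at h1
  rw [hS.inner_tanakaWebster_add _ ((he.smooth i).mdiffAt hx) ((hs i).mdiffAt hx),
    ← hS.mlieBracket_reeb ((hs i).mdiffAt hx), hT.jacobi (he.smooth i) hY hx,
    hS.mlieBracket_eq ((hw i).mdiffAt hx) (hY.mdiffAt hx),
    hS.mlieBracket_eq ((he.smooth i).mdiffAt hx) (hY.mdiffAt hx)]
  rw [hwT i x hx] at h1 ⊢
  simp only [inner_sub_right, inner_add_right, inner_smul_right, LinearMap.sub_apply,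
    LinearMap.smulRight_apply, innerₗ_apply_apply, ContinuousLinearMap.coe_coe]
  rw [real_inner_comm (e i x) (S.tanakaWebster (mlieBracket I S.reeb (e i)) x (Y x))] at h1
  rw [real_inner_comm (e i x) (S.J x (Y x)),
    real_inner_comm (S.tanakaWebster (e i) x (S.reeb x)) (S.J x (Y x))]
  linarith

/-- Since [T, ∇_H f] = ∇_T ∇_H f = ∇_H(Tf), this is the previous lemma for Y = ∇_H f. -/
lemma subLaplacian_along_reeb (hS : S.IsSasakian) (he : IsOrthonormalFrameOn e U)
    (hf : SmoothFunOn I U f) (hx : x ∈ U) :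
    S.subLaplacian (along S.reeb f) x = along S.reeb (S.subLaplacian f) x := by
  have hZ := S.smooth_horizontalGradient he hf
  have h := hS.divergence_mlieBracket_reeb he hx hZ
  change _ = along S.reeb (divergence (S.horizontalGradient f)) x
  rw [← h, subLaplacian, divergence, divergence]
  congr 2
  refine covariantDerivative_congr_of_eqOn _ he.isOpen
    (S.smooth_horizontalGradient he (S.smooth_along he.isOpen S.smooth_reeb hf)) (fun y hy ↦ ?_) hx
  rw [hS.mlieBracket_reeb (hZ.mdiffAt hy), hS.tanakaWebster_reeb_horizontalGradient he hf hy]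

end IsSasakian

end PseudohermitianStructure

/-- An operation on vector fields which is local, additive and homogeneous over smooth functions
on the open set `U`, as far as its value at `x` is concerned. -/
structure SmoothTensorialAt {A : Type*} [AddCommGroup A] [Module ℝ A] (U : Set M)
    (Φ : (Π x : M, TangentSpace I x) → A) (x : M) : Prop where
  congr : ∀ {X Y}, SmoothFieldOn U X → (∀ y ∈ U, X y = Y y) → Φ X = Φ Y
  add : ∀ {X Y}, SmoothFieldOn U X → SmoothFieldOn U Y → Φ (X + Y) = Φ X + Φ Y
  smul : ∀ {f : M → ℝ} {X}, SmoothFunOn I U f → SmoothFieldOn U X → Φ (f • X) = f x • Φ X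

lemma SmoothTensorialAt.eq_sum {A : Type*} [AddCommGroup A] [Module ℝ A]
    {Φ : (Π x : M, TangentSpace I x) → A} (hΦ : SmoothTensorialAt U Φ x) {ι : Type*} [Fintype ι]
    {e : ι → Π x : M, TangentSpace I x} (he : IsOrthonormalFrameOn e U) (hX : SmoothFieldOn U X) :
    Φ X = ∑ i, inner ℝ (e i x) (X x) • Φ (e i) := by
  have hi : ∀ i, SmoothFunOn I U (fun y ↦ inner ℝ (e i y) (X y)) :=
    fun i ↦ (he.smooth i).inner hX
  have hsum : ∀ s : Finset ι, Φ (fun y ↦ ∑ i ∈ s, inner ℝ (e i y) (X y) • e i y) =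
      ∑ i ∈ s, inner ℝ (e i x) (X x) • Φ (e i) := by
    intro s
    classical
    induction s using Finset.induction_on with
    | empty =>
      have h := hΦ.smul (SmoothFunOn.const 0) hX
      simp only [Finset.sum_empty]
      rw [zero_smul] at h
      rw [← h]
      congr 1
      ext y
      simp
    | insert a s ha ih =>
      simp only [Finset.sum_insert ha]
      rw [← ih, ← hΦ.smul (hi a) (he.smooth a)]
      exact hΦ.add (SmoothFieldOn.smul (hi a) (he.smooth a))
        (SmoothFieldOn.sum fun i _ ↦ SmoothFieldOn.smul (hi i) (he.smooth i))
  rw [← hsum]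
  exact hΦ.congr hX fun y hy ↦ (he.sum_inner_smul hy _).symm

lemma SmoothTensorialAt.eq_of_eq {A : Type*} [AddCommGroup A] [Module ℝ A]
    {Φ : (Π x : M, TangentSpace I x) → A} (hΦ : SmoothTensorialAt U Φ x) {ι : Type*} [Fintype ι]
    {e : ι → Π x : M, TangentSpace I x} (he : IsOrthonormalFrameOn e U) (hX : SmoothFieldOn U X)
    (hY : SmoothFieldOn U Y) (hXY : X x = Y x) : Φ X = Φ Y := by
  rw [hΦ.eq_sum he hX, hΦ.eq_sum he hY, hXY]

lemma curvature_swap (cov : CovariantDerivative I E (fun x : M ↦ TangentSpace I x))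
    (X Y Z : Π x : M, TangentSpace I x) (x : M) :
    curvature cov X Y Z x = - curvature cov Y X Z x := by
  rw [curvature, curvature, mlieBracket_swap_apply, map_neg]
  module

/-! ### Tensoriality of the curvature and the Ricci trace -/

namespace PseudohermitianStructure

variable {S : PseudohermitianStructure I M} {ι : Type*} [Fintype ι]
  {e : ι → Π x : M, TangentSpace I x}

lemma curvature_tensorial_left (S : PseudohermitianStructure I M) (he : IsOrthonormalFrameOn e U)
    (hx : x ∈ U) (hZ : SmoothFieldOn U Z) :
    SmoothTensorialAt U (fun X ↦ curvature S.tanakaWebster X Y Z x) x where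
  congr {X X'} hX hXX' := by
    have h1 := covariantDerivative_congr_of_eqOn S.tanakaWebster he.isOpen
      (S.smooth_tanakaWebster he hX hZ) (Y := fun y ↦ S.tanakaWebster Z y (X' y))
      (fun y hy ↦ by rw [hXX' y hy]) hx
    simp only [curvature]
    rw [h1, hXX' x hx, mlieBracket_congr_of_eqOn he.isOpen hXX' (fun _ _ ↦ rfl) hx]
  add {X X'} hX hX' := by
    have h1 : (fun y ↦ S.tanakaWebster Z y ((X + X') y)) =
        (fun y ↦ S.tanakaWebster Z y (X y)) + fun y ↦ S.tanakaWebster Z y (X' y) := by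
      ext y; simp
    simp only [curvature]
    rw [h1, S.tanakaWebster.isCovariantDerivativeOn.add
      ((S.smooth_tanakaWebster he hX hZ).mdiffAt hx)
      ((S.smooth_tanakaWebster he hX' hZ).mdiffAt hx),
      mlieBracket_add_left (hX.mdiffAt hx) (hX'.mdiffAt hx)]
    simp only [Pi.add_apply, map_add, add_apply]
    module
  smul {f X} hf hX := by
    have h1 : (fun y ↦ S.tanakaWebster Z y ((f • X) y)) =
        f • (fun y ↦ S.tanakaWebster Z y (X y)) := by
      ext y; simp
    simp only [curvature]
    rw [h1, S.tanakaWebster.isCovariantDerivativeOn.leibniz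
      ((S.smooth_tanakaWebster he hX hZ).mdiffAt hx) (hf.mdiffAt hx),
      mlieBracket_smul_left (hf.mdiffAt hx) (hX.mdiffAt hx)]
    simp only [Pi.smul_apply', map_add, map_smul, add_apply, smul_apply,
      ContinuousLinearMap.smulRight_apply]
    module

lemma curvature_tensorial_right (S : PseudohermitianStructure I M)
    (he : IsOrthonormalFrameOn e U) (hx : x ∈ U) (hX : SmoothFieldOn U X)
    (hY : SmoothFieldOn U Y) :
    SmoothTensorialAt U (fun Z ↦ curvature S.tanakaWebster X Y Z x) x where
  congr {Z Z'} hZ hZZ' := by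
    have h0 : ∀ y ∈ U, S.tanakaWebster Z y = S.tanakaWebster Z' y :=
      fun y hy ↦ covariantDerivative_congr_of_eqOn _ he.isOpen hZ hZZ' hy
    have h1 := covariantDerivative_congr_of_eqOn S.tanakaWebster he.isOpen
      (S.smooth_tanakaWebster he hX hZ) (Y := fun y ↦ S.tanakaWebster Z' y (X y))
      (fun y hy ↦ by rw [h0 y hy]) hx
    have h2 := covariantDerivative_congr_of_eqOn S.tanakaWebster he.isOpen
      (S.smooth_tanakaWebster he hY hZ) (Y := fun y ↦ S.tanakaWebster Z' y (Y y))
      (fun y hy ↦ by rw [h0 y hy]) hx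
    simp only [curvature]
    rw [h1, h2, h0 x hx]
  add {Z Z'} hZ hZ' := by
    have h0 : ∀ {V : Π x : M, TangentSpace I x}, SmoothFieldOn U V →
        S.tanakaWebster (fun y ↦ S.tanakaWebster (Z + Z') y (V y)) x =
          S.tanakaWebster (fun y ↦ S.tanakaWebster Z y (V y)) x
          + S.tanakaWebster (fun y ↦ S.tanakaWebster Z' y (V y)) x := by
      intro V hV
      rw [← S.tanakaWebster.isCovariantDerivativeOn.add
        ((S.smooth_tanakaWebster he hV hZ).mdiffAt hx)
        ((S.smooth_tanakaWebster he hV hZ').mdiffAt hx)]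
      refine covariantDerivative_congr_of_eqOn _ he.isOpen
        (S.smooth_tanakaWebster he hV (hZ.add hZ')) (fun y hy ↦ ?_) hx
      rw [S.tanakaWebster.isCovariantDerivativeOn.add (hZ.mdiffAt hy) (hZ'.mdiffAt hy)]
      rfl
    simp only [curvature]
    rw [h0 hX, h0 hY, S.tanakaWebster.isCovariantDerivativeOn.add (hZ.mdiffAt hx) (hZ'.mdiffAt hx)]
    simp only [add_apply]
    module
  smul {f Z} hf hZ := by
    have h0 : ∀ {V : Π x : M, TangentSpace I x}, SmoothFieldOn U V → ∀ v,
        S.tanakaWebster (fun y ↦ S.tanakaWebster (f • Z) y (V y)) x v =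
          f x • S.tanakaWebster (fun y ↦ S.tanakaWebster Z y (V y)) x v
          + mvfderiv I f x v • S.tanakaWebster Z x (V x)
          + along V f x • S.tanakaWebster Z x v + mvfderiv I (along V f) x v • Z x := by
      intro V hV v
      have hVf := S.smooth_along he.isOpen hV hf
      have hVZ := S.smooth_tanakaWebster he hV hZ
      have h1 : S.tanakaWebster (fun y ↦ S.tanakaWebster (f • Z) y (V y)) x =
          S.tanakaWebster (f • (fun y ↦ S.tanakaWebster Z y (V y)) + along V f • Z) x := by
        refine covariantDerivative_congr_of_eqOn _ he.isOpen
          (S.smooth_tanakaWebster he hV (SmoothFieldOn.smul hf hZ)) (fun y hy ↦ ?_) hx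
        rw [S.tanakaWebster.isCovariantDerivativeOn.leibniz (hZ.mdiffAt hy) (hf.mdiffAt hy)]
        rfl
      rw [h1, S.tanakaWebster.isCovariantDerivativeOn.add
        ((SmoothFieldOn.smul hf hVZ).mdiffAt hx) ((SmoothFieldOn.smul hVf hZ).mdiffAt hx),
        S.tanakaWebster.isCovariantDerivativeOn.leibniz (hVZ.mdiffAt hx) (hf.mdiffAt hx),
        S.tanakaWebster.isCovariantDerivativeOn.leibniz (hZ.mdiffAt hx) (hVf.mdiffAt hx)]
      simp only [add_apply, smul_apply, ContinuousLinearMap.smulRight_apply]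
      module
    -- The second derivatives of f enter only as XYf - YXf - [X, Y]f = 0.
    have h2 := S.along_mlieBracket he.isOpen hX hY hf hx
    simp only [curvature]
    rw [h0 hX, h0 hY,
      S.tanakaWebster.isCovariantDerivativeOn.leibniz (hZ.mdiffAt hx) (hf.mdiffAt hx)]
    simp only [along, add_apply, smul_apply, ContinuousLinearMap.smulRight_apply] at h2 ⊢
    rw [h2]
    module

/-- Frees the Ricci tensor from the particular extensions and basis in its definition, so that it
can be evaluated on the field Z itself inside the Bochner computation. -/
lemma ricci_eq_sum (S : PseudohermitianStructure I M) (he : IsOrthonormalFrameOn e U) (hx : x ∈ U)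
    (hext : ∀ v : TangentSpace I x, SmoothFieldOn U (extend E v)) (hV : SmoothFieldOn U V)
    (hW : SmoothFieldOn U W) :
    ricci S.tanakaWebster x (V x) (W x) =
      ∑ i, inner ℝ (e i x) (curvature S.tanakaWebster (e i) V W x) := by
  set b := stdOrthonormalBasis ℝ (TangentSpace I x) with hb
  have h1 : ∀ v : TangentSpace I x,
      curvature S.tanakaWebster (extend E v) (extend E (V x)) (extend E (W x)) x =
        ∑ i, inner ℝ (e i x) v • curvature S.tanakaWebster (e i) V W x := by
    intro v
    have h2 := (S.curvature_tensorial_right he hx (hext v) (hext (V x))).eq_of_eq he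
      (hext (W x)) hW (extend_apply_self E (W x))
    have h3 := (S.curvature_tensorial_left (Y := extend E v) he hx hW).eq_of_eq he
      (hext (V x)) hV (extend_apply_self E (V x))
    have h4 := (S.curvature_tensorial_left (Y := V) he hx hW).eq_sum he (hext v)
    rw [extend_apply_self] at h4
    rw [h2, curvature_swap, h3, ← curvature_swap, h4]
  have h5 : ricci S.tanakaWebster x (V x) (W x) = ∑ j, ∑ i, inner ℝ (e i x) (b j) *
      inner ℝ (curvature S.tanakaWebster (e i) V W x) (b j) := by
    rw [ricci]
    refine Finset.sum_congr rfl fun j _ ↦ ?_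
    rw [h1, sum_inner]
    simp only [inner_smul_left, conj_trivial, hb]
  rw [h5, Finset.sum_comm]
  refine Finset.sum_congr rfl fun i _ ↦ ?_
  rw [← b.sum_inner_mul_inner]
  refine Finset.sum_congr rfl fun j _ ↦ ?_
  rw [real_inner_comm (b j) (curvature S.tanakaWebster (e i) V W x)]

/-! ### The covariant derivative of J and the vanishing of its trace -/

lemma mdiffAt_J (S : PseudohermitianStructure I M) (hX : MDiffAt (T% X) x) :
    MDiffAt (T% (fun y ↦ S.J y (X y))) x :=
  MDifferentiableAt.clm_bundle_apply (E₁ := fun x : M ↦ TangentSpace I x)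
    (E₂ := fun x : M ↦ TangentSpace I x) (b := fun y ↦ y)
    ((S.contMDiff_J x).mdifferentiableAt (by simp)) hX

lemma covariantDerivJ_tensorial (S : PseudohermitianStructure I M) (x : M) :
    TensorialAt I E (fun Z : Π x : M, TangentSpace I x ↦
      S.tanakaWebster (fun y ↦ S.J y (Z y)) x - (S.J x).comp (S.tanakaWebster Z x)) x where
  smul {f Z} hf hZ := by
    have h : (fun y ↦ S.J y ((f • Z) y)) = f • fun y ↦ S.J y (Z y) := by ext y; simp
    rw [h, S.tanakaWebster.isCovariantDerivativeOn.leibniz (S.mdiffAt_J hZ) hf,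
      S.tanakaWebster.isCovariantDerivativeOn.leibniz hZ hf]
    ext v
    simp only [sub_apply, add_apply, smul_apply, ContinuousLinearMap.smulRight_apply,
      ContinuousLinearMap.comp_apply, map_add, map_smul]
    module
  add {Z Z'} hZ hZ' := by
    have h : (fun y ↦ S.J y ((Z + Z') y)) = (fun y ↦ S.J y (Z y)) + fun y ↦ S.J y (Z' y) := by
      ext y; simp
    rw [h, S.tanakaWebster.isCovariantDerivativeOn.add (S.mdiffAt_J hZ) (S.mdiffAt_J hZ'),
      S.tanakaWebster.isCovariantDerivativeOn.add hZ hZ']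
    ext v
    simp only [sub_apply, add_apply, ContinuousLinearMap.comp_apply, map_add]
    module

/-- The covariant derivative `(∇_v J) w` of the complex structure; the arguments are in the order
`w`, `v`. -/
def covariantDerivJ (S : PseudohermitianStructure I M) (x : M) :
    TangentSpace I x →L[ℝ] TangentSpace I x →L[ℝ] TangentSpace I x :=
  TensorialAt.mkHom _ x (S.covariantDerivJ_tensorial x)

lemma covariantDerivJ_apply (hZ : MDiffAt (T% Z) x) (v : TangentSpace I x) :
    S.covariantDerivJ x (Z x) v =
      S.tanakaWebster (fun y ↦ S.J y (Z y)) x v - S.J x (S.tanakaWebster Z x v) := by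
  rw [covariantDerivJ, TensorialAt.mkHom_apply (S.covariantDerivJ_tensorial x) hZ]
  rfl

/-- This is d(dθ) = 0: second derivatives of the functions θ(X), θ(Y), θ(Z) pair into commutators,
and θ of the double brackets cancels by Jacobi. -/
lemma oneFormDeriv_contactForm_closed
    (S : PseudohermitianStructure I M) (hU : IsOpen U) (hx : x ∈ U) (hX : SmoothFieldOn U X)
    (hY : SmoothFieldOn U Y) (hZ : SmoothFieldOn U Z) :
    along X (fun y ↦ inner ℝ (Y y) (S.J y (Z y))) x
      + along Y (fun y ↦ inner ℝ (Z y) (S.J y (X y))) x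
      + along Z (fun y ↦ inner ℝ (X y) (S.J y (Y y))) x =
    inner ℝ (mlieBracket I X Y x) (S.J x (Z x)) + inner ℝ (mlieBracket I Y Z x) (S.J x (X x))
      + inner ℝ (mlieBracket I Z X x) (S.J x (Y x)) := by
  have h1 : ∀ {A B C : Π x : M, TangentSpace I x}, SmoothFieldOn U A → SmoothFieldOn U B →
      SmoothFieldOn U C → along A (fun y ↦ inner ℝ (B y) (S.J y (C y))) x =
        along A (along B fun y ↦ S.contactForm y (C y)) x
        - along A (along C fun y ↦ S.contactForm y (B y)) x
        - along A (fun y ↦ S.contactForm y (mlieBracket I B C y)) x := by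
    intro A B C hA hB hC
    have h := mvfderiv_congr_of_eqOn (I := I) hU (fun y hy ↦
      (S.oneFormDeriv_contactForm B C y (hB.mdiffAt hy) (hC.mdiffAt hy)).symm) hx
    have hs1 := S.smooth_along hU hB (S.smooth_contactForm hC)
    have hs2 := S.smooth_along hU hC (S.smooth_contactForm hB)
    have hs3 := S.smooth_contactForm (hB.mlieBracket hC)
    rw [along, h]
    rw [show oneFormDeriv S.contactForm B C = fun y ↦
      along B (fun z ↦ S.contactForm z (C z)) y - along C (fun z ↦ S.contactForm z (B z)) y
      - S.contactForm y (mlieBracket I B C y) from rfl,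
      mvfderiv_fun_sub ((hs1.sub hs2).mdiffAt hx) (hs3.mdiffAt hx),
      mvfderiv_fun_sub (hs1.mdiffAt hx) (hs2.mdiffAt hx)]
    rfl
  have h2 : ∀ {A B C : Π x : M, TangentSpace I x}, SmoothFieldOn U A → SmoothFieldOn U B →
      SmoothFieldOn U C → inner ℝ (mlieBracket I A B x) (S.J x (C x)) =
        along A (along B fun y ↦ S.contactForm y (C y)) x
        - along B (along A fun y ↦ S.contactForm y (C y)) x
        - along C (fun y ↦ S.contactForm y (mlieBracket I A B y)) x
        - S.contactForm x (mlieBracket I (mlieBracket I A B) C x) := by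
    intro A B C hA hB hC
    rw [← S.along_mlieBracket hU hA hB (S.smooth_contactForm hC) hx]
    exact (S.oneFormDeriv_contactForm _ C x ((hA.mlieBracket hB).mdiffAt hx)
      (hC.mdiffAt hx)).symm
  have h3 := congrArg (S.contactForm x) (hX.jacobi hY hZ hx)
  rw [map_add, mlieBracket_swap_apply (V := X), mlieBracket_swap_apply (V := Y)
    (W := mlieBracket I X Z), mlieBracket_swap (V := X) (W := Z), map_neg, map_neg,
    ← neg_one_smul ℝ (mlieBracket I Z X),
    mlieBracket_const_smul_left ((hZ.mlieBracket hX).mdiffAt hx)] at h3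
  rw [map_smul, smul_eq_mul] at h3
  rw [h1 hX hY hZ, h1 hY hZ hX, h1 hZ hX hY, h2 hX hY hZ, h2 hY hZ hX, h2 hZ hX hY]
  linarith

namespace IsSasakian

lemma inner_covariantDerivJ_swap (hS : S.IsSasakian) (u v w : TangentSpace I x) :
    inner ℝ v (S.covariantDerivJ x w u) = - inner ℝ w (S.covariantDerivJ x v u) := by
  have hv : MDiffAt (T% (extend E v)) x := mdifferentiableAt_extend ..
  have hw : MDiffAt (T% (extend E w)) x := mdifferentiableAt_extend ..
  have h1 := hS.inner_tanakaWebster_add u hv (S.mdiffAt_J hw)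
  have h2 := hS.inner_tanakaWebster_add u hw (S.mdiffAt_J hv)
  have h3 : (fun y ↦ inner ℝ (extend E v y) (S.J y (extend E w y))) =
      -fun y ↦ inner ℝ (extend E w y) (S.J y (extend E v y)) := by
    ext y; rw [S.inner_J_swap]; rfl
  rw [h3, mvfderiv_neg, neg_apply, h2] at h1
  have h4 := S.covariantDerivJ_apply hv u
  have h5 := S.covariantDerivJ_apply hw u
  rw [extend_apply_self] at h1 h4 h5
  rw [extend_apply_self] at h1
  rw [h4, h5, inner_sub_right, inner_sub_right, S.inner_J_swap x v, S.inner_J_swap x w]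
  linarith

/-- Differentiate J² = -1 + θ ⊗ T, whose right side is parallel. -/
lemma covariantDerivJ_J (hS : S.IsSasakian) (u w : TangentSpace I x) :
    S.covariantDerivJ x (S.J x w) u = - S.J x (S.covariantDerivJ x w u) := by
  have hw : MDiffAt (T% (extend E w)) x := mdifferentiableAt_extend ..
  have h1 := S.covariantDerivJ_apply hw u
  have h2 := S.covariantDerivJ_apply (S.mdiffAt_J hw) u
  rw [extend_apply_self] at h1 h2
  have hθ : MDiffAt (fun y ↦ S.contactForm y (extend E w y)) x := by
    simpa only [S.inner_reeb] using mdiffAt_inner S.mdiffAt_reeb hw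
  have h3 : (fun y ↦ S.J y (S.J y (extend E w y))) =
      (-1 : ℝ) • extend E w + (fun y ↦ S.contactForm y (extend E w y)) • S.reeb := by
    ext y; rw [S.J_J]; simp
  have hc : MDiffAt (T% ((-1 : ℝ) • extend E w)) x := hw.smul_const_section
  rw [h3, S.tanakaWebster.isCovariantDerivativeOn.add hc (hθ.smul_section S.mdiffAt_reeb),
    S.tanakaWebster.isCovariantDerivativeOn.smul_const (-1) hw,
    S.tanakaWebster.isCovariantDerivativeOn.leibniz S.mdiffAt_reeb hθ] at h2
  rw [h2, h1, map_sub, S.J_J, hS.contactForm_tanakaWebster hw]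
  simp only [add_apply, smul_apply, ContinuousLinearMap.smulRight_apply, S.tanakaWebster_reeb]
  module

/-- Closedness of g(·, J·) expressed through ∇. The torsion is a multiple of T, hence orthogonal to
the image of J, and leaves no trace. -/
lemma covariantDerivJ_cyclic (hS : S.IsSasakian) (he : IsOrthonormalFrameOn e U) (hx : x ∈ U)
    (u v w : TangentSpace I x) :
    inner ℝ v (S.covariantDerivJ x w u) + inner ℝ w (S.covariantDerivJ x u v)
      + inner ℝ u (S.covariantDerivJ x v w) = 0 := by
  have key : ∀ a b c : TangentSpace I x, inner ℝ b (S.covariantDerivJ x c a) =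
      along (frameExtend e a)
        (fun y ↦ inner ℝ (frameExtend e b y) (S.J y (frameExtend e c y))) x
      - inner ℝ (S.tanakaWebster (frameExtend e b) x a) (S.J x c)
      + inner ℝ (S.tanakaWebster (frameExtend e c) x a) (S.J x b) := by
    intro a b c
    have hb := (he.smooth_frameExtend b).mdiffAt hx
    have hc := (he.smooth_frameExtend c).mdiffAt hx
    have h1 := hS.inner_tanakaWebster_add a hb (S.mdiffAt_J hc)
    have h2 := S.covariantDerivJ_apply hc a
    rw [he.frameExtend_self hx] at h1 h2
    rw [along, he.frameExtend_self hx, h1, h2, inner_sub_right, S.inner_J_swap x b,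
      he.frameExtend_self hx]
    ring
  have hbr : ∀ a b c : TangentSpace I x,
      inner ℝ (mlieBracket I (frameExtend e a) (frameExtend e b) x) (S.J x c) =
      inner ℝ (S.tanakaWebster (frameExtend e b) x a) (S.J x c)
      - inner ℝ (S.tanakaWebster (frameExtend e a) x b) (S.J x c) := by
    intro a b c
    rw [hS.mlieBracket_eq ((he.smooth_frameExtend a).mdiffAt hx)
      ((he.smooth_frameExtend b).mdiffAt hx), he.frameExtend_self hx, he.frameExtend_self hx,
      inner_sub_left, inner_sub_left, inner_smul_left, S.inner_reeb, S.contactForm_J]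
    ring
  have h := S.oneFormDeriv_contactForm_closed he.isOpen hx (he.smooth_frameExtend u)
    (he.smooth_frameExtend v) (he.smooth_frameExtend w)
  simp only [he.frameExtend_self hx, hbr] at h
  rw [key, key, key]
  linarith

/-- Put u = e_i, v = J e_i in the cyclic identity and sum. With N w = (u ↦ (∇_u J) w) and P = ∇_w J
this reads tr N(Jw) - tr(N w ∘ J) + tr(PJ) = 0. Anticommutation with J makes the last trace zero and
the middle one -tr N(Jw), so tr N(Jw) = 0. -/
lemma trace_covariantDerivJ (hS : S.IsSasakian) (he : IsOrthonormalFrameOn e U) (hx : x ∈ U)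
    (w : TangentSpace I x) (hw : S.contactForm x w = 0) :
    LinearMap.trace ℝ (TangentSpace I x) (S.covariantDerivJ x w : _ →ₗ[ℝ] _) = 0 := by
  let J : TangentSpace I x →ₗ[ℝ] TangentSpace I x := S.J x
  let N : TangentSpace I x → (TangentSpace I x →ₗ[ℝ] TangentSpace I x) :=
    fun w ↦ S.covariantDerivJ x w
  have hJ : ∀ w, LinearMap.trace ℝ _ (N (S.J x w)) = 0 := by
    intro w
    have hNJ : N (S.J x w) = - (J * N w) := by
      ext u; exact hS.covariantDerivJ_J u w
    let P : TangentSpace I x →ₗ[ℝ] TangentSpace I x := (S.covariantDerivJ x).flip w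
    have hPJ : P * J = - (J * P) := by
      ext u; exact hS.covariantDerivJ_J w u
    have hP : LinearMap.trace ℝ _ (P * J) = 0 := by
      have h := congrArg (LinearMap.trace ℝ _) hPJ
      rw [map_neg, LinearMap.trace_mul_comm ℝ J P] at h
      linarith
    have hN : LinearMap.trace ℝ _ (N w * J) = - LinearMap.trace ℝ _ (N (S.J x w)) := by
      rw [hNJ, map_neg, neg_neg, LinearMap.trace_mul_comm]
    have h : ∑ i, (inner ℝ (e i x) (N (S.J x w) (e i x)) - inner ℝ (e i x) ((N w * J) (e i x))
        + inner ℝ (e i x) ((P * J) (e i x))) = 0 := by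
      refine Finset.sum_eq_zero fun i _ ↦ ?_
      have h := hS.covariantDerivJ_cyclic he hx (e i x) (S.J x (e i x)) w
      rw [S.inner_J_left, hS.inner_covariantDerivJ_swap (S.J x (e i x)) w] at h
      rw [hNJ]
      simp only [LinearMap.neg_apply, inner_neg_right]
      exact h
    rw [Finset.sum_add_distrib, Finset.sum_sub_distrib, ← he.trace_eq hx, ← he.trace_eq hx,
      ← he.trace_eq hx, hN, hP] at h
    linarith
  -- A horizontal w is J(-Jw).
  have h := hJ (- S.J x w)
  rw [map_neg, S.J_J, hw, zero_smul, add_zero, neg_neg] at h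
  exact h

lemma divergence_J (hS : S.IsSasakian) (he : IsOrthonormalFrameOn e U) (hx : x ∈ U)
    (hZ : SmoothFieldOn U Z) (hZ0 : S.contactForm x (Z x) = 0) :
    divergence (fun y ↦ S.J y (Z y)) x = LinearMap.trace ℝ (TangentSpace I x)
      ((S.J x : TangentSpace I x →ₗ[ℝ] TangentSpace I x) * S.tanakaWebster Z x) := by
  have h : (S.tanakaWebster (fun y ↦ S.J y (Z y)) x : TangentSpace I x →ₗ[ℝ] TangentSpace I x) =
      (S.covariantDerivJ x (Z x) : TangentSpace I x →ₗ[ℝ] TangentSpace I x)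
      + (S.J x : TangentSpace I x →ₗ[ℝ] TangentSpace I x) * S.tanakaWebster Z x := by
    ext v
    simp [S.covariantDerivJ_apply (hZ.mdiffAt hx)]
  rw [hS.divergence_eq_trace, h, map_add, hS.trace_covariantDerivJ he hx _ hZ0, zero_add]

end IsSasakian

end PseudohermitianStructure

/-! ### Cauchy-Schwarz for the horizontal Hessian matrix -/

section MatrixInequality

variable {ι : Type*} [Fintype ι]

/-- Cauchy-Schwarz against the projection δ - θθᵀ, whose squared Hilbert-Schmidt norm is its rank.
Projecting off θ is what improves the constant from the dimension to the dimension minus one. -/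
lemma sq_sum_diag_le (A : ι → ι → ℝ) (θ : ι → ℝ) (hθ : ∑ i, θ i * θ i = 1)
    (hA : ∑ i, ∑ j, A i j * (θ i * θ j) = 0) :
    (∑ i, A i i) ^ 2 ≤ ((Fintype.card ι : ℝ) - 1) * ∑ i, ∑ j, A i j ^ 2 := by
  classical
  let P : ι × ι → ℝ := fun p ↦ (if p.1 = p.2 then 1 else 0) - θ p.1 * θ p.2
  have h := Finset.sum_mul_sq_le_sq_mul_sq (Finset.univ : Finset (ι × ι)) P (fun p ↦ A p.1 p.2)
  have h1 : ∑ p, P p * A p.1 p.2 = ∑ i, A i i := by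
    have h2 : ∑ p, P p * A p.1 p.2 = ∑ i, ∑ j, ((if i = j then A i j else 0)
        - A i j * (θ i * θ j)) := by
      rw [Fintype.sum_prod_type]
      refine Finset.sum_congr rfl fun i _ ↦ Finset.sum_congr rfl fun j _ ↦ ?_
      simp only [P]
      split_ifs <;> ring
    rw [h2]
    simp only [Finset.sum_sub_distrib, hA, sub_zero]
    simp
  have h3 : ∑ p, P p ^ 2 = (Fintype.card ι : ℝ) - 1 := by
    have h4 : ∑ p, P p ^ 2 = ∑ i, ∑ j, ((if i = j then 1 - 2 * (θ i * θ j) else 0)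
        + (θ i * θ i) * (θ j * θ j)) := by
      rw [Fintype.sum_prod_type]
      refine Finset.sum_congr rfl fun i _ ↦ Finset.sum_congr rfl fun j _ ↦ ?_
      simp only [P]
      split_ifs <;> ring
    rw [h4]
    simp only [Finset.sum_add_distrib, ← Finset.mul_sum, ← Finset.sum_mul, hθ]
    simp [Finset.sum_sub_distrib, ← Finset.mul_sum, hθ]
    ring
  rw [h1, h3, Fintype.sum_prod_type] at h
  exact h

/-- Here B is the matrix of ∇Z and t its row in the direction T. Subtracting θ ⊗ t leaves the
horizontal block D, with the same trace and the same trace of the square, whose antisymmetric part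
is -τΩ/2. The previous lemma is applied to the symmetric part of D. -/
lemma sq_sum_diag_le_of_sub_eq (B Ω : ι → ι → ℝ) (θ v : ι → ℝ) (τ : ℝ)
    (hθ : ∑ i, θ i * θ i = 1) (hB : ∀ i, ∑ j, B i j * θ j = 0)
    (hΩθ : ∀ j, ∑ i, θ i * Ω i j = 0)
    (hΩ : ∑ i, ∑ j, Ω i j ^ 2 = (Fintype.card ι : ℝ) - 1)
    (hsub : ∀ i j, B i j - B j i = - Ω i j * τ - θ j * v i + θ i * v j) :
    (∑ i, B i i) ^ 2 ≤ ((Fintype.card ι : ℝ) - 1) *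
      (∑ i, ∑ j, B i j * B j i + ((Fintype.card ι : ℝ) - 1) / 4 * τ ^ 2) := by
  let c := ∑ i, θ i * v i
  let t : ι → ℝ := fun j ↦ v j - c * θ j
  have ht : ∀ j, ∑ i, θ i * B i j = t j := by
    intro j
    have h1 : ∑ i, θ i * B i j = ∑ i, (B j i * θ i - τ * (θ i * Ω i j) - θ j * (θ i * v i)
        + v j * (θ i * θ i)) := by
      refine Finset.sum_congr rfl fun i _ ↦ ?_
      linear_combination θ i * hsub i j
    rw [h1, Finset.sum_add_distrib, Finset.sum_sub_distrib, Finset.sum_sub_distrib,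
      ← Finset.mul_sum, ← Finset.mul_sum, ← Finset.mul_sum, hB, hΩθ, hθ]
    simp only [t, c]
    ring
  have htθ : ∑ j, t j * θ j = 0 := by
    have h1 : ∑ j, t j * θ j = ∑ j, ∑ i, θ i * (B i j * θ j) := by
      refine Finset.sum_congr rfl fun j _ ↦ ?_
      rw [← ht, Finset.sum_mul]
      exact Finset.sum_congr rfl fun i _ ↦ by ring
    rw [h1, Finset.sum_comm]
    exact Finset.sum_eq_zero fun i _ ↦ by rw [← Finset.mul_sum, hB, mul_zero]
  let D : ι → ι → ℝ := fun i j ↦ B i j - θ i * t j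
  have hD : ∀ i, ∑ j, D i j * θ j = 0 := by
    intro i
    have h1 : ∑ j, D i j * θ j = ∑ j, (B i j * θ j - θ i * (t j * θ j)) :=
      Finset.sum_congr rfl fun j _ ↦ by simp only [D]; ring
    rw [h1, Finset.sum_sub_distrib, ← Finset.mul_sum, hB, htθ]
    ring
  have hDsub : ∀ i j, D i j - D j i = - Ω i j * τ := by
    intro i j
    simp only [D, t]
    linear_combination hsub i j
  have hdiag : ∑ i, B i i = ∑ i, (D i i + D i i) / 2 := by
    have h1 : ∑ i, (D i i + D i i) / 2 = ∑ i, (B i i - t i * θ i) :=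
      Finset.sum_congr rfl fun i _ ↦ by simp only [D]; ring
    rw [h1, Finset.sum_sub_distrib, htθ, sub_zero]
  have hBD : ∑ i, ∑ j, B i j * B j i = ∑ i, ∑ j, D i j * D j i := by
    have h1 : ∑ i, ∑ j, B i j * B j i = ∑ i, ∑ j, (D i j * D j i + t i * (D i j * θ j)
        + θ i * (t j * D j i) + (t i * θ i) * (t j * θ j)) :=
      Finset.sum_congr rfl fun i _ ↦ Finset.sum_congr rfl fun j _ ↦ by simp only [D]; ring
    have h2 : ∑ i, ∑ j, θ i * (t j * D j i) = 0 := by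
      rw [Finset.sum_comm]
      refine Finset.sum_eq_zero fun j _ ↦ ?_
      rw [← mul_zero (t j), ← hD j, Finset.mul_sum]
      exact Finset.sum_congr rfl fun i _ ↦ by ring
    rw [h1]
    simp only [Finset.sum_add_distrib]
    rw [h2]
    simp only [← Finset.mul_sum, hD, htθ]
    simp
  -- Entrywise ((a + b)/2)² = ab + ((a - b)/2)², with a - b = -Ωτ.
  have hsq : ∑ i, ∑ j, ((D i j + D j i) / 2) ^ 2 =
      ∑ i, ∑ j, D i j * D j i + ((Fintype.card ι : ℝ) - 1) / 4 * τ ^ 2 := by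
    rw [← hΩ]
    have h1 : ∑ i, ∑ j, ((D i j + D j i) / 2) ^ 2 =
        ∑ i, ∑ j, (D i j * D j i + Ω i j ^ 2 * (τ ^ 2 / 4)) := by
      refine Finset.sum_congr rfl fun i _ ↦ Finset.sum_congr rfl fun j _ ↦ ?_
      linear_combination (D i j - D j i - Ω i j * τ) / 4 * hDsub i j
    rw [h1]
    simp only [Finset.sum_add_distrib, ← Finset.sum_mul]
    ring
  have hA : ∑ i, ∑ j, (D i j + D j i) / 2 * (θ i * θ j) = 0 := by
    have h1 : ∑ i, ∑ j, (D i j + D j i) / 2 * (θ i * θ j) =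
        ∑ i, ∑ j, (θ i / 2 * (D i j * θ j) + θ j / 2 * (D j i * θ i)) :=
      Finset.sum_congr rfl fun i _ ↦ Finset.sum_congr rfl fun j _ ↦ by ring
    rw [h1]
    simp only [Finset.sum_add_distrib]
    rw [Finset.sum_comm (f := fun i j ↦ θ j / 2 * (D j i * θ i))]
    simp only [← Finset.mul_sum, hD]
    simp
  have h := sq_sum_diag_le (fun i j ↦ (D i j + D j i) / 2) θ hθ hA
  rw [hsq, ← hdiag, ← hBD] at h
  exact h

end MatrixInequality

lemma divergence_congr_of_eqOn (hU : IsOpen U) (hX : SmoothFieldOn U X)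
    (hXY : ∀ y ∈ U, X y = Y y) (hx : x ∈ U) : divergence X x = divergence Y x := by
  rw [divergence, divergence, covariantDerivative_congr_of_eqOn _ hU hX hXY hx]

/-! ### Γ-calculus, Bochner identities and the curvature-dimension inequality -/

namespace PseudohermitianStructure

variable {S : PseudohermitianStructure I M} {ι : Type*} [Fintype ι]
  {e : ι → Π x : M, TangentSpace I x}

lemma mvfderiv_of_horizontal (S : PseudohermitianStructure I M) (f : M → ℝ)
    {v : TangentSpace I x} (hv : S.contactForm x v = 0) :
    mvfderiv I f x v = inner ℝ (S.horizontalGradient f x) v := by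
  rw [inner_horizontalGradient, hv]
  ring

lemma horizontalGradient_mul (S : PseudohermitianStructure I M) (hf : MDiffAt f x)
    (hh : MDiffAt h x) :
    S.horizontalGradient (fun y ↦ f y * h y) x =
      f x • S.horizontalGradient h x + h x • S.horizontalGradient f x := by
  refine ext_inner_right ℝ fun w ↦ ?_
  rw [inner_add_left, inner_smul_left, inner_smul_left]
  simp only [inner_horizontalGradient, mvfderiv_fun_mul hf hh, add_apply, smul_apply, smul_eq_mul,
    conj_trivial]
  ring

lemma subLaplacian_mul (S : PseudohermitianStructure I M) (he : IsOrthonormalFrameOn e U)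
    (hf : SmoothFunOn I U f) (hh : SmoothFunOn I U h) (hx : x ∈ U) :
    S.subLaplacian (fun y ↦ f y * h y) x = f x * S.subLaplacian h x + h x * S.subLaplacian f x
      + 2 * inner ℝ (S.horizontalGradient f x) (S.horizontalGradient h x) := by
  have hZf := S.smooth_horizontalGradient he hf
  have hZh := S.smooth_horizontalGradient he hh
  have h1 : S.subLaplacian (fun y ↦ f y * h y) x =
      divergence (f • S.horizontalGradient h + h • S.horizontalGradient f) x :=
    divergence_congr_of_eqOn he.isOpen (S.smooth_horizontalGradient he (hf.mul hh))
      (fun y hy ↦ S.horizontalGradient_mul (hf.mdiffAt hy) (hh.mdiffAt hy)) hx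
  rw [h1, divergence_add ((SmoothFieldOn.smul hf hZh).mdiffAt hx)
    ((SmoothFieldOn.smul hh hZf).mdiffAt hx), divergence_smul (hf.mdiffAt hx) (hZh.mdiffAt hx),
    divergence_smul (hh.mdiffAt hx) (hZf.mdiffAt hx), along, along,
    S.mvfderiv_of_horizontal f (S.contactForm_horizontalGradient h x),
    S.mvfderiv_of_horizontal h (S.contactForm_horizontalGradient f x),
    real_inner_comm (S.horizontalGradient h x) (S.horizontalGradient f x), subLaplacian,
    subLaplacian]
  ring

lemma gammaForm_subLaplacian (S : PseudohermitianStructure I M) (he : IsOrthonormalFrameOn e U)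
    (hf : SmoothFunOn I U f) (hh : SmoothFunOn I U h) (hx : x ∈ U) :
    gammaForm S.subLaplacian f h x =
      inner ℝ (S.horizontalGradient f x) (S.horizontalGradient h x) := by
  rw [gammaForm, S.subLaplacian_mul he hf hh hx]
  ring

lemma sum_contactForm_sq (S : PseudohermitianStructure I M)
    (he : IsOrthonormalFrameOn e U) (hx : x ∈ U) :
    ∑ i, S.contactForm x (e i x) * S.contactForm x (e i x) = 1 := by
  simp only [← S.inner_reeb_right]
  rw [he.sum_inner_mul_inner hx, S.inner_reeb, S.contactForm_reeb]

lemma sum_contactForm_mul (S : PseudohermitianStructure I M)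
    (he : IsOrthonormalFrameOn e U) (hx : x ∈ U)
    (A : TangentSpace I x →ₗ[ℝ] ℝ) :
    ∑ i, S.contactForm x (e i x) * A (e i x) = A (S.reeb x) := by
  conv_rhs => rw [← he.sum_inner_smul hx (S.reeb x)]
  simp [S.inner_reeb_right]

lemma inner_J_J_frame (S : PseudohermitianStructure I M)
    (he : IsOrthonormalFrameOn e U) (hx : x ∈ U) (i : ι) :
    inner ℝ (e i x) (S.J x (S.J x (e i x))) =
      - (1 - S.contactForm x (e i x) * S.contactForm x (e i x)) := by
  rw [S.J_J, inner_add_right, inner_neg_right, inner_smul_right, S.inner_reeb_right,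
    real_inner_self_eq_norm_sq, (he.orthonormal x hx).1 i]
  ring

lemma sum_inner_J_sq (S : PseudohermitianStructure I M)
    (he : IsOrthonormalFrameOn e U) (hx : x ∈ U) :
    ∑ i, ∑ j, inner ℝ (e i x) (S.J x (e j x)) ^ 2 = (Fintype.card ι : ℝ) - 1 := by
  rw [Finset.sum_comm]
  have h : ∀ j, ∑ i, inner ℝ (e i x) (S.J x (e j x)) ^ 2 =
      1 - S.contactForm x (e j x) * S.contactForm x (e j x) := by
    intro j
    simp only [sq]
    rw [he.sum_inner_mul_inner hx, S.inner_J_left, S.inner_J_J_frame he hx, neg_neg]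
  rw [Finset.sum_congr rfl fun j _ ↦ h j, Finset.sum_sub_distrib, S.sum_contactForm_sq he hx]
  simp

namespace IsSasakian

lemma gammaTwoForm_verticalForm (hS : S.IsSasakian) (he : IsOrthonormalFrameOn e U)
    (hf : SmoothFunOn I U f) (hx : x ∈ U) :
    gammaTwoForm S.subLaplacian S.verticalForm f f x =
      inner ℝ (S.horizontalGradient (along S.reeb f) x)
        (S.horizontalGradient (along S.reeb f) x) := by
  have hτ := S.smooth_along he.isOpen S.smooth_reeb hf
  have h1 : S.verticalForm f f = fun y ↦ along S.reeb f y * along S.reeb f y := rfl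
  have h2 : S.verticalForm f (S.subLaplacian f) x =
      along S.reeb f x * along S.reeb (S.subLaplacian f) x := rfl
  rw [gammaTwoForm, h1, h2, S.subLaplacian_mul he hτ hτ hx, hS.subLaplacian_along_reeb he hf hx]
  ring

/-- As J is skew, tr(JN) sees only the antisymmetric part of N: the asymmetry formula at e_i, J e_i
is summed over the frame. The derivative of τ enters only along JT = 0. -/
lemma trace_J_mul_tanakaWebster (hS : S.IsSasakian) (he : IsOrthonormalFrameOn e U)
    (hf : SmoothFunOn I U f) (hx : x ∈ U) :
    LinearMap.trace ℝ (TangentSpace I x)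
      ((S.J x : TangentSpace I x →ₗ[ℝ] TangentSpace I x)
        * S.tanakaWebster (S.horizontalGradient f) x) =
      - (((Fintype.card ι : ℝ) - 1) / 2) * along S.reeb f x := by
  set J := (S.J x).toLinearMap with hJ
  set N := (S.tanakaWebster (S.horizontalGradient f) x).toLinearMap with hN
  have h1 := he.trace_eq hx (J * N)
  have h2 := he.trace_eq hx (N * J)
  rw [LinearMap.trace_mul_comm] at h2
  have h3 : ∑ i, (inner ℝ (e i x) ((J * N) (e i x)) + inner ℝ (e i x) ((N * J) (e i x))) =
      - ∑ i, ((1 - S.contactForm x (e i x) * S.contactForm x (e i x)) * along S.reeb f x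
        + S.contactForm x (e i x) *
          (mvfderiv I (along S.reeb f) x).toLinearMap.comp J (e i x)) := by
    rw [← Finset.sum_neg_distrib]
    refine Finset.sum_congr rfl fun i _ ↦ ?_
    have h := hS.tanakaWebster_horizontalGradient_sub he hf hx (e i x) (S.J x (e i x))
    rw [S.inner_J_J_frame he hx, S.contactForm_J, S.inner_J_swap x _ (e i x),
      real_inner_comm (e i x)] at h
    simp only [Module.End.mul_apply, LinearMap.comp_apply, hJ, hN, ContinuousLinearMap.coe_coe]
    linarith
  rw [Finset.sum_add_distrib, ← h1, ← h2, Finset.sum_add_distrib, ← Finset.sum_mul,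
    S.sum_contactForm_mul he hx, Finset.sum_sub_distrib, S.sum_contactForm_sq he hx] at h3
  simp only [LinearMap.comp_apply, hJ, ContinuousLinearMap.coe_coe, S.J_reeb, map_zero,
    Finset.sum_const, Finset.card_univ, nsmul_eq_mul, mul_one] at h3 ⊢
  linarith

lemma sq_subLaplacian_le (hS : S.IsSasakian) (he : IsOrthonormalFrameOn e U)
    (hf : SmoothFunOn I U f) (hx : x ∈ U) :
    S.subLaplacian f x ^ 2 ≤ ((Fintype.card ι : ℝ) - 1) *
      (∑ i, inner ℝ (e i x) (S.tanakaWebster (S.horizontalGradient f) x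
        (S.tanakaWebster (S.horizontalGradient f) x (e i x)))
        + ((Fintype.card ι : ℝ) - 1) / 4 * along S.reeb f x ^ 2) := by
  have hZ := S.smooth_horizontalGradient he hf
  set N := S.tanakaWebster (S.horizontalGradient f) x with hN
  have h := sq_sum_diag_le_of_sub_eq (fun i j ↦ inner ℝ (N (e i x)) (e j x))
    (fun i j ↦ inner ℝ (e i x) (S.J x (e j x))) (fun i ↦ S.contactForm x (e i x))
    (fun i ↦ mvfderiv I (along S.reeb f) x (e i x)) (along S.reeb f x)
    (S.sum_contactForm_sq he hx) (fun i ↦ ?_) (fun j ↦ ?_) (S.sum_inner_J_sq he hx)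
    (fun i j ↦ hS.tanakaWebster_horizontalGradient_sub he hf hx (e i x) (e j x))
  · have h1 : S.subLaplacian f x = ∑ i, inner ℝ (N (e i x)) (e i x) := by
      rw [subLaplacian, hS.divergence_eq_sum he hx]
      exact Finset.sum_congr rfl fun i _ ↦ real_inner_comm _ _
    have h2 : ∑ i, inner ℝ (e i x) (N (N (e i x))) =
        ∑ i, ∑ j, inner ℝ (N (e i x)) (e j x) * inner ℝ (N (e j x)) (e i x) := by
      refine Finset.sum_congr rfl fun i _ ↦ ?_
      conv_lhs => rw [← he.sum_inner_smul hx (N (e i x))]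
      rw [map_sum, inner_sum]
      refine Finset.sum_congr rfl fun j _ ↦ ?_
      rw [map_smul, inner_smul_right, real_inner_comm (e j x), real_inner_comm (e i x)]
    rw [h1, h2]
    exact h
  · have h1 := S.sum_contactForm_mul he hx (innerₗ (TangentSpace I x) (N (e i x)))
    simp only [innerₗ_apply_apply, S.inner_reeb_right] at h1
    rw [hN, hS.contactForm_tanakaWebster_of_horizontal (hZ.mdiffAt hx)
      (S.contactForm_horizontalGradient f)] at h1
    rw [← h1]
    exact Finset.sum_congr rfl fun j _ ↦ mul_comm _ _
  · have h1 := S.sum_contactForm_mul he hx (innerₗ (TangentSpace I x) (S.J x (e j x)))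
    simp only [innerₗ_apply_apply, S.inner_reeb_right, S.contactForm_J] at h1
    rw [← h1]
    exact Finset.sum_congr rfl fun i _ ↦ by rw [real_inner_comm]

lemma gammaTwoForm_gammaForm (hS : S.IsSasakian) (he : IsOrthonormalFrameOn e U)
    (hf : ContMDiff I 𝓘(ℝ, ℝ) ∞ f) (hx : x ∈ U)
    (hext : ∀ v : TangentSpace I x, SmoothFieldOn U (extend E v)) :
    gammaTwoForm S.subLaplacian (gammaForm S.subLaplacian) f f x =
      ricci S.tanakaWebster x (S.horizontalGradient f x) (S.horizontalGradient f x)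
      + ∑ i, inner ℝ (e i x) (S.tanakaWebster (S.horizontalGradient f) x
        (S.tanakaWebster (S.horizontalGradient f) x (e i x)))
      - 2 * inner ℝ (S.horizontalGradient (along S.reeb f) x)
        (S.J x (S.horizontalGradient f x))
      + ((Fintype.card ι : ℝ) - 1) / 2 * along S.reeb f x ^ 2 := by
  have hfU : SmoothFunOn I U f := fun y _ ↦ hf y
  have hτ := S.smooth_along he.isOpen S.smooth_reeb hfU
  set Z := S.horizontalGradient f with hZdef
  have hZ : SmoothFieldOn U Z := S.smooth_horizontalGradient he hfU
  have hJZ := S.smooth_J hZ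
  have hZZ := S.smooth_tanakaWebster he hZ hZ
  -- L is applied to Γ(f), so an identity of functions on M is needed; hence a frame around each
  -- point y.
  have hΓ : gammaForm S.subLaplacian f f = fun y ↦ inner ℝ (Z y) (Z y) := by
    ext y
    obtain ⟨V, e', hy, he', -⟩ := exists_orthonormalFrame I y
    have hfV : SmoothFunOn I V f := fun z _ ↦ hf z
    exact S.gammaForm_subLaplacian he' hfV hfV hy
  have hLΓ : S.subLaplacian (fun y ↦ inner ℝ (Z y) (Z y)) x =
      2 * (divergence (fun y ↦ S.tanakaWebster Z y (Z y)) x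
        - (along S.reeb f x * divergence (fun y ↦ S.J y (Z y)) x
          + along (fun y ↦ S.J y (Z y)) (along S.reeb f) x)) := by
    have h1 : S.subLaplacian (fun y ↦ inner ℝ (Z y) (Z y)) x = divergence
        ((2 : ℝ) • ((fun y ↦ S.tanakaWebster Z y (Z y))
          + (-1 : ℝ) • (along S.reeb f • fun y ↦ S.J y (Z y)))) x := by
      refine divergence_congr_of_eqOn he.isOpen
        (S.smooth_horizontalGradient he (hZ.inner hZ)) (fun y hy ↦ ?_) hx
      rw [hS.horizontalGradient_inner_self he hfU hy]
      simp only [Pi.smul_apply, Pi.add_apply, Pi.smul_apply', hZdef]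
      module
    have h2 := SmoothFieldOn.smul hτ hJZ
    have h3 : SmoothFieldOn U ((-1 : ℝ) • (along S.reeb f • fun y ↦ S.J y (Z y))) :=
      SmoothFieldOn.smul (SmoothFunOn.const (-1)) h2
    rw [h1, divergence_const_smul _ ((hZZ.add h3).mdiffAt hx),
      divergence_add (hZZ.mdiffAt hx) (h3.mdiffAt hx), divergence_const_smul _ (h2.mdiffAt hx),
      divergence_smul (hτ.mdiffAt hx) (hJZ.mdiffAt hx)]
    ring
  have hL := S.smooth_subLaplacian he hfU
  rw [gammaTwoForm, hΓ, hLΓ, S.gammaForm_subLaplacian he hfU hL hx,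
    hS.divergence_tanakaWebster he hx hZ hZ,
    hS.divergence_J he hx hZ (S.contactForm_horizontalGradient f x),
    hS.trace_J_mul_tanakaWebster he hfU hx, S.ricci_eq_sum he hx hext hZ hZ,
    hS.tanakaWebster_reeb_horizontalGradient he hfU hx]
  -- This term cancels Γ(f, Lf).
  have h4 : along Z (divergence Z) x =
      inner ℝ (Z x) (S.horizontalGradient (S.subLaplacian f) x) := by
    rw [real_inner_comm]
    exact S.mvfderiv_of_horizontal _ (S.contactForm_horizontalGradient f x)
  have h5 : along (fun y ↦ S.J y (Z y)) (along S.reeb f) x =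
      inner ℝ (S.horizontalGradient (along S.reeb f) x) (S.J x (Z x)) :=
    S.mvfderiv_of_horizontal _ (S.contactForm_J x _)
  rw [h4, h5]
  ring

lemma curvatureDimension (hS : S.IsSasakian) (n : ℕ) (hn : 0 < n)
    (hE : Module.finrank ℝ E = 2 * n + 1) (ρ₁ : ℝ)
    (hRic : ∀ f : M → ℝ, ContMDiff I 𝓘(ℝ, ℝ) ∞ f → ∀ x : M,
      ricci S.tanakaWebster x (S.horizontalGradient f x) (S.horizontalGradient f x) ≥
        ρ₁ * ‖S.horizontalGradient f x‖ ^ 2) :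
    CurvatureDimension I S.subLaplacian S.verticalForm ρ₁ ((n : ℝ) / 2) 1 (2 * (n : ℝ≥0∞)) := by
  have hn' : (0 : ℝ) < n := by exact_mod_cast hn
  refine ⟨by positivity, zero_le_one, ?_, fun f hf ν hν x ↦ ?_⟩
  · have : (0 : ℝ≥0∞) < n := by exact_mod_cast hn
    exact ENNReal.mul_pos two_ne_zero this.ne'
  obtain ⟨U, e, hx, he, hext⟩ := exists_orthonormalFrame I x
  have hfU : SmoothFunOn I U f := fun y _ ↦ hf y
  have hd : ((2 * (n : ℝ≥0∞))⁻¹).toReal = (2 * (n : ℝ))⁻¹ := by simp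
  have hcard : ((Fintype.card (Fin (Module.finrank ℝ E)) : ℝ) - 1) = 2 * n := by
    rw [Fintype.card_fin, hE]; push_cast; ring
  have h1 := hS.gammaTwoForm_gammaForm he hf hx hext
  have h2 := hS.sq_subLaplacian_le he hfU hx
  rw [hcard] at h1 h2
  have h3 := hRic f hf x
  have hv : S.verticalForm f f x = along S.reeb f x ^ 2 := (sq _).symm
  rw [hd, hv, h1, hS.gammaTwoForm_verticalForm he hfU hx,
    S.gammaForm_subLaplacian he hfU hfU hx]
  set Z := S.horizontalGradient f x
  set W := S.horizontalGradient (along S.reeb f) x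
  set q := ∑ i, inner ℝ (e i x) (S.tanakaWebster (S.horizontalGradient f) x
    (S.tanakaWebster (S.horizontalGradient f) x (e i x)))
  have hJZ : inner ℝ (S.J x Z) (S.J x Z) = inner ℝ Z Z :=
    S.norm_J_sq x Z (S.contactForm_horizontalGradient f x)
  -- Expand |νW - JZ|² ≥ 0 and divide by ν, using |JZ| = |Z|.
  have h4 : 2 * inner ℝ W (S.J x Z) ≤ ν * inner ℝ W W + 1 / ν * inner ℝ Z Z := by
    have h5 : 0 ≤ inner ℝ (ν • W - S.J x Z) (ν • W - S.J x Z) := real_inner_self_nonneg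
    rw [real_inner_sub_sub_self, inner_smul_left, inner_smul_left, inner_smul_right, hJZ] at h5
    simp only [conj_trivial] at h5
    have h6 := mul_nonneg (one_div_pos.2 hν).le h5
    have h7 : 1 / ν * (ν * (ν * inner ℝ W W) - 2 * (ν * inner ℝ W (S.J x Z)) + inner ℝ Z Z) =
        ν * inner ℝ W W + 1 / ν * inner ℝ Z Z - 2 * inner ℝ W (S.J x Z) := by
      field_simp
      ring
    linarith
  -- With `Fintype.card` equal to 2n + 1, the matrix inequality has factor 2n and τ²-coefficient
  -- 2n/4 = n/2.
  have h8 : (2 * (n : ℝ))⁻¹ * S.subLaplacian f x ^ 2 ≤ q + n / 2 * along S.reeb f x ^ 2 := by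
    rw [inv_mul_le_iff₀ (by positivity)]
    calc _ ≤ _ := h2
      _ = _ := by ring
  rw [← real_inner_self_eq_norm_sq] at h3
  have h9 : (2 : ℝ) * n / 2 = n := by ring
  rw [h9]
  linarith

end IsSasakian

end PseudohermitianStructure

end SasakianBochner

end CRGeometry

end

theorem theoremT (n : ℕ) (hn : 0 < n) {M : Type*} [TopologicalSpace M] [T2Space M]
    [SecondCountableTopology M] [ChartedSpace (EuclideanSpace ℝ (Fin (2 * n + 1))) M]
    [IsManifold (𝓡 (2 * n + 1)) ∞ M]
    [RiemannianBundle (fun x : M ↦ TangentSpace (𝓡 (2 * n + 1)) x)]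
    [IsContMDiffRiemannianBundle (𝓡 (2 * n + 1)) ∞ (EuclideanSpace ℝ (Fin (2 * n + 1)))
      (fun x : M ↦ TangentSpace (𝓡 (2 * n + 1)) x)]
    (S : CRGeometry.PseudohermitianStructure (𝓡 (2 * n + 1)) M) (hS : S.IsSasakian) (ρ₁ : ℝ)
    (hRic : ∀ f : M → ℝ, ContMDiff (𝓡 (2 * n + 1)) 𝓘(ℝ, ℝ) ∞ f → ∀ x : M,
      CRGeometry.ricci S.tanakaWebster x (S.horizontalGradient f x) (S.horizontalGradient f x) ≥
        ρ₁ * ‖S.horizontalGradient f x‖ ^ 2) :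
    CRGeometry.CurvatureDimension (𝓡 (2 * n + 1)) S.subLaplacian S.verticalForm
      ρ₁ ((n : ℝ) / 2) 1 (2 * (n : ℝ≥0∞)) := by
  exact hS.curvatureDimension n hn (by simp) ρ₁ hRic
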